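/- \textbf{Setting.} Fix $N\ge 2$. For every $T>0$ let $H=H_T:[0,1]\to\mathbb C^{N\times N}$ be a three times continuously differentiable path of Hermitian matrices (it may depend on $T$), with non-degenerate energy levels $E_0(s)<E_1(s)<\dots<E_{N-1}(s)$, and put $\lambda_l(s)=E_l(s)-E_0(s)$. For an integer $L\ge 1$ (the circuit depth) put $\delta t=T/L$, $s_j=j/L$, and let $$A_d=U_L\cdots U_2U_1,\qquad U_j=\exp[-iH(s_j)\,\delta t].$$ Let $|\psi_i\rangle$, $|\psi_f\rangle$ be normalized ground states of $H(0)$ and $H(1)$, and let $\epsilon_{\mathrm{adb}}=\sqrt{1-|\langle\psi_f|A_d|\psi_i\rangle|^2}$ be the fidelity error. Norms of matrices are spectral norms. \textbf{Assumptions.} As $T\to\infty$, uniformly in $s\in[0,1]$, $\|H'(s)\|=O(1)$, $\|H''(s)\|=o(\sqrt T)$ and $\|H'''(s)\|=o(T)$; and there is $g>0$ with $|E_l(s)-E_m(s)|\ge g$ for all $l\ne m$, all $s\in[0,1]$ and all large $T$. \textbf{Conclusion.} There is an absolute constant $C$ such that every such family satisfies the following. (1) If $\max_{s=0,1}\|H'(s)\|\ge\kappa$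 for some constant $\kappa>0$ and all large $T$, then for all sufficiently large $T$ and all $L\ge 1$ with $\max_{l,s}\lambda_l(s)\,\delta t<3.78$, $$\epsilon_{\mathrm{adb}}\le C\max_{s=0,1}\frac{\|H'(s)\|}{T\lambda_1(s)^2}.$$ (2) Without this lower bound on $H'$: for every $\eta>0$, for all sufficiently large $T$ and all $L\ge1$ with $\max_{l,s}\lambda_l(s)\,\delta t<3.78$, $$\epsilon_{\mathrm{adb}}\le C\max_{s=0,1}\frac{\|H'(s)\|+\eta}{T\lambda_1(s)^2}.$$ (3) (Depth linear in $T$.) If $\max_{l,s}\lambda_l(s)\le W$ for a constant $W$ and all large $T$, then for every constant $a>W/3.78$ the depth $L=\lceil aT\rceil$ satisfies $\max_{l,s}\lambda_l(s)\,\delta t<3.78$ for all large $T$, and with this depth $\epsilon_{\mathrm{adb}}=O(1/T)$. -/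

import Mathlib

open Filter Set
open scoped Topology

noncomputable section

namespace DiscreteAdiabatic

/-- The state space `ℂ^N`, with its Euclidean inner product. -/
abbrev State (N : ℕ) : Type := EuclideanSpace ℂ (Fin N)

/-- Operators on `ℂ^N`; the norm is the operator (spectral) norm. -/
abbrev Op (N : ℕ) : Type := State N →L[ℂ] State N

/-- The `k`-th derivative on `[0, 1]` (one-sided at the endpoints) of a path of operators. -/
def pathDeriv {N : ℕ} (k : ℕ) (H : ℝ → Op N) (s : ℝ) : Op N :=
  iteratedDerivWithin k H (Icc 0 1) s

/-- `E 0 < E 1 < ⋯` are eigenvalues of `A`. As there are `N` of them, they are all the eigenvalues,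
listed in increasing order, and every eigenvalue is non-degenerate. -/
def IsEnergyLevels {N : ℕ} (A : Op N) (E : Fin N → ℝ) : Prop :=
  StrictMono E ∧ ∀ l, Module.End.HasEigenvalue (A : State N →ₗ[ℂ] State N) (E l : ℂ)

/-- `ψ` is a normalized eigenvector of `A` with eigenvalue `e`. -/
def IsEigenstate {N : ℕ} (A : Op N) (e : ℝ) (ψ : State N) : Prop :=
  ‖ψ‖ = 1 ∧ A ψ = (e : ℂ) • ψ

/-- The `j`-th step `U_j = exp(-i H(s_j) δt)`, with `s_j = j / L` and `δt = T / L`. -/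
def stepOp {N : ℕ} (H : ℝ → Op N) (T : ℝ) (L j : ℕ) : Op N :=
  NormedSpace.exp ((-(Complex.I * ((T / L : ℝ) : ℂ))) • H ((j : ℝ) / L))

/-- The time-ordered product `U_k ⋯ U_2 U_1` of the first `k` of the `L` steps. -/
def partialPropagator {N : ℕ} (H : ℝ → Op N) (T : ℝ) (L : ℕ) : ℕ → Op N
  | 0 => 1
  | k + 1 => stepOp H T L (k + 1) * partialPropagator H T L k

/-- The discretized adiabatic operator `A_d = U_L ⋯ U_2 U_1`. -/
def discretePropagator {N : ℕ} (H : ℝ → Op N) (T : ℝ) (L : ℕ) : Op N :=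
  partialPropagator H T L L

/-- The fidelity error `√(1 - |⟨ψ_f| A_d |ψ_i⟩|²)`. -/
def fidelityError {N : ℕ} (H : ℝ → Op N) (T : ℝ) (L : ℕ) (ψi ψf : State N) : ℝ :=
  Real.sqrt (1 - ‖inner ℂ ψf (discretePropagator H T L ψi)‖ ^ 2)

/-- The gap above the ground level, `λ₁ = E₁ - E₀`. -/
def gap {d : ℕ} (E : Fin (d + 2) → ℝ) : ℝ := E 1 - E 0

/-- The condition `max_{l, s} (E_l(s) - E_0(s)) δt < 3.78`, with `δt = T / L`. -/
def StepCondition {d : ℕ} (E : ℝ → Fin (d + 2) → ℝ) (T : ℝ) (L : ℕ) : Prop :=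
  ∀ s ∈ Icc (0 : ℝ) 1, ∀ l, (E s l - E s 0) * (T / L) < 3.78

/-- `max_{s = 0, 1} a(s) / (T λ₁(s)²)`. -/
def endpointMax {d : ℕ} (a : ℝ → ℝ) (E : ℝ → Fin (d + 2) → ℝ) (T : ℝ) : ℝ :=
  max (a 0 / (T * gap (E 0) ^ 2)) (a 1 / (T * gap (E 1) ^ 2))

/-- With `L` steps, the fidelity error is at most `B`, for all choices of (normalized) ground
states `ψ_i` of `H(0)` and `ψ_f` of `H(1)`. -/
def ErrorAtMost {d : ℕ} (H : ℝ → Op (d + 2)) (E : ℝ → Fin (d + 2) → ℝ) (T : ℝ) (L : ℕ)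
    (B : ℝ) : Prop :=
  ∀ ψi ψf : State (d + 2), IsEigenstate (H 0) (E 0 0) ψi → IsEigenstate (H 1) (E 1 0) ψf →
    fidelityError H T L ψi ψf ≤ B

end DiscreteAdiabatic

end

/-! The proof is a discrete adiabatic theorem to second order, in which only the endpoint terms are
of leading order. Let `P j` be the projection onto the ground state of `H(s_j)`; it is a spectral
projection of the step `U j`. For phases `0 ≤ φ < 3.78 < 2π` one has `|exp(iφ) - 1| ≥ 0.4 φ`, so the
ground phase of `U j` stays at distance at least `γ = 0.4 Λ δt` from the others, where `Λ` bounds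
the energy gap from below. Hence `X ↦ U X - X U` can be inverted on off-diagonal blocks at cost
`1/γ`.

Write the derivative bounds as `‖H⁽ᵏ⁾‖ ≤ Λ σᵏ / 100` for `k = 1, 2, 3`, and put `ρ = σ/L`. Then the
`k`-th differences of `U` are `O(γ ρᵏ)` (Duhamel, `norm_exp_differences`), and those of `P` are
`O(ρᵏ)` (commutator and idempotent identities, differenced). The range of `P` is not carried to the
next one by a step: the error is `O(ρ)`. `exists_correction` tilts it to the graph of an
off-diagonal `X = Y + Z`, where `Y` of size `ρ/γ` cancels the motion of `P` and `Z` of size `(ρ/γ)²`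
cancels the motion of `Y`. The tilted range is then invariant up to `ρ (ρ/γ)²` per step. A Grönwall
argument (`norm_transition_le`) sums these defects. What remains at first order is the tilt at the
two ends and the loss in the first two steps, and these give `‖H'‖ / (T λ₁²)` at `s = 0, 1`.

Since `ρ/γ = σ/(0.4 Λ T)`, the depth cancels and the total remainder is of order `(σ² + σ³)/(Λ T)²`.
The choice `σ³ = θ T` is compatible with `‖H'‖ = O(1)`, `‖H''‖ = o(√T)` and `‖H'''‖ = o(T)`, and
makes the remainder `O(θ/(Λ² T))`. A small constant `θ` hides it in the `η` of the second claim. The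
first claim follows by taking `η` proportional to `κ`, the third by taking `η = 1`. -/

namespace DiscreteAdiabatic

/-! ### Finite differences, spectral gaps and gapped sequences -/

section Differences

variable {B : Type*} [NormedRing B]

/-- The forward difference of a sequence. -/
def fdiff (F : ℕ → B) (j : ℕ) : B := F (j + 1) - F j

/-- The `k`-th differences of `F`, for `k ≤ n`, are at most `c ρ ^ (m + k)`, as far as they only
involve entries of index at most `M - r`. -/
def DiffBound (ρ : ℝ) (M r m n : ℕ) (c : ℝ) (F : ℕ → B) : Prop :=
  ∀ k ≤ n, ∀ j, j + k + r ≤ M → ‖(fdiff^[k] F) j‖ ≤ c * ρ ^ (m + k)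

variable {ρ γ c c' : ℝ} {M r m m' n : ℕ} {F G : ℕ → B}

theorem fdiff_iterate_shift (F : ℕ → B) (k : ℕ) :
    fdiff^[k] (fun j => F (j + 1)) = fun j => (fdiff^[k] F) (j + 1) := by
  induction k generalizing F with
  | zero => rfl
  | succ k ih =>
    rw [Function.iterate_succ_apply, Function.iterate_succ_apply, ← ih (fdiff F)]
    rfl

theorem fdiff_iterate_add (F G : ℕ → B) (k : ℕ) (j : ℕ) :
    (fdiff^[k] (F + G)) j = (fdiff^[k] F) j + (fdiff^[k] G) j := by
  induction k generalizing F G with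
  | zero => rfl
  | succ k ih =>
    rw [Function.iterate_succ_apply, Function.iterate_succ_apply, Function.iterate_succ_apply,
      ← ih]
    have : fdiff (F + G) = fdiff F + fdiff G := by
      funext i
      simp only [fdiff, Pi.add_apply]
      abel
    rw [this]

namespace DiffBound

theorem fdiff (h : DiffBound ρ M r m (n + 1) c F) :
    DiffBound ρ M (r + 1) (m + 1) n c (fdiff F) := by
  intro k hk j hj
  have := h (k + 1) (by omega) j (by omega)
  rwa [Function.iterate_succ_apply, show m + (k + 1) = m + 1 + k by ring] at this

theorem shift (h : DiffBound ρ M r m n c F) :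
    DiffBound ρ M (r + 1) m n c (fun j => F (j + 1)) := by
  intro k hk j hj
  rw [fdiff_iterate_shift]
  exact h k hk (j + 1) (by omega)

theorem mono (h : DiffBound ρ M r m n c F) {n' r' : ℕ} (hn : n' ≤ n) (hr : r ≤ r') (hρ : 0 ≤ ρ)
    (hc : c ≤ c') : DiffBound ρ M r' m n' c' F := fun k hk j hj =>
  (h k (hk.trans hn) j (by omega)).trans (by gcongr)

theorem add (hF : DiffBound ρ M r m n c F) (hG : DiffBound ρ M r m n c' G) :
    DiffBound ρ M r m n (c + c') (F + G) := by
  intro k hk j hj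
  rw [fdiff_iterate_add, add_mul]
  exact (norm_add_le _ _).trans (add_le_add (hF k hk j hj) (hG k hk j hj))

theorem of_fdiff (h0 : ∀ j, j + r ≤ M → ‖F j‖ ≤ c * ρ ^ m)
    (h : DiffBound ρ M (r + 1) (m + 1) n c (DiscreteAdiabatic.fdiff F)) :
    DiffBound ρ M r m (n + 1) c F := by
  intro k hk j hj
  rcases k with _ | k
  · exact h0 j (by omega)
  · rw [Function.iterate_succ_apply, show m + (k + 1) = m + 1 + k by ring]
    exact h k (by omega) j (by omega)

theorem norm_le (h : DiffBound ρ M r m n c F) {j : ℕ} (hj : j + r ≤ M) : ‖F j‖ ≤ c * ρ ^ m :=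
  h 0 (Nat.zero_le _) j (by omega)

theorem norm_fdiff_le (h : DiffBound ρ M r m n c F) (hn : 1 ≤ n) {j : ℕ} (hj : j + 1 + r ≤ M) :
    ‖DiscreteAdiabatic.fdiff F j‖ ≤ c * ρ ^ (m + 1) :=
  h 1 hn j (by omega)

theorem norm_fdiff_two_le (h : DiffBound ρ M r m n c F) (hn : 2 ≤ n) {j : ℕ}
    (hj : j + 2 + r ≤ M) :
    ‖DiscreteAdiabatic.fdiff (DiscreteAdiabatic.fdiff F) j‖ ≤ c * ρ ^ (m + 2) :=
  h 2 hn j (by omega)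

/-- The discrete Leibniz rule `Δ(F G) j = ΔF j * G (j + 1) + F j * ΔG j` has two terms, so each
further difference doubles the constant; this gives the factor `2 ^ n`. -/
theorem mul (hρ : 0 ≤ ρ) (hc : 0 ≤ c) (hF : DiffBound ρ M r m n c F)
    (hG : DiffBound ρ M r m' n c' G) : DiffBound ρ M r (m + m') n (2 ^ n * c * c') (F * G) := by
  have key : ∀ {r m m' : ℕ} {F G : ℕ → B}, (∀ j, j + r ≤ M → ‖F j‖ ≤ c * ρ ^ m) →
      (∀ j, j + r ≤ M → ‖G j‖ ≤ c' * ρ ^ m') →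
      ∀ j, j + r ≤ M → ‖(F * G) j‖ ≤ c * c' * ρ ^ (m + m') := by
    intro r m m' F G hF hG j hj
    calc ‖F j * G j‖ ≤ ‖F j‖ * ‖G j‖ := norm_mul_le _ _
      _ ≤ (c * ρ ^ m) * (c' * ρ ^ m') :=
        mul_le_mul (hF j hj) (hG j hj) (norm_nonneg _) (by positivity)
      _ = c * c' * ρ ^ (m + m') := by ring
  induction n generalizing r m m' F G with
  | zero =>
    intro k hk j hj
    obtain rfl : k = 0 := by omega
    have := key (fun j hj => hF.norm_le hj) (fun j hj => hG.norm_le hj) j (by omega)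
    simpa using this
  | succ n ih =>
    have h1 := ih hF.fdiff (hG.shift.mono (Nat.le_succ n) le_rfl hρ le_rfl)
    have h2 := ih (hF.mono (Nat.le_succ n) (Nat.le_succ r) hρ le_rfl) hG.fdiff
    rw [show m + (m' + 1) = m + 1 + m' by ring] at h2
    refine of_fdiff (fun j hj => ?_) ?_
    · refine (key (fun j hj => hF.norm_le hj) (fun j hj => hG.norm_le hj) j hj).trans ?_
      have h0 := key (fun j hj => hF.norm_le hj) (fun j hj => hG.norm_le hj) j hj
      have : c * c' * ρ ^ (m + m') ≤ 2 ^ (n + 1) * (c * c' * ρ ^ (m + m')) :=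
        le_mul_of_one_le_left ((norm_nonneg _).trans h0) (one_le_pow₀ (by norm_num))
      linarith
    · convert h1.add h2 using 1
      · ring
      · ring
      · funext j
        simp only [DiscreteAdiabatic.fdiff, Pi.mul_apply, Pi.add_apply]
        noncomm_ring

end DiffBound

/-- `U` commutes with the idempotent `P`, and the commutator with `U` is bounded below by `γ`
and invertible on the blocks that are off-diagonal with respect to `P`. -/
structure SpectralGap (U P : B) (γ : ℝ) : Prop where
  norm_lower_le : ∀ X, γ * ‖(1 - P) * X * P‖ ≤ ‖U * X - X * U‖
  norm_upper_le : ∀ X, γ * ‖P * X * (1 - P)‖ ≤ ‖U * X - X * U‖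
  exists_solution : ∀ F, ∃ X, P * X = 0 ∧ X * P = X ∧ U * X - X * U = (1 - P) * F * P

/-- A sequence `U 0, …, U M` of contractions with spectral projections `P j`, with a gap `γ` and
with `k`-th differences of order `γ ρ ^ k`. -/
structure GappedSequence (M : ℕ) (γ ρ : ℝ) (U P : ℕ → B) : Prop where
  γ_pos : 0 < γ
  γ_le : γ ≤ 2
  ρ_nonneg : 0 ≤ ρ
  ρ_le : ρ ≤ γ
  norm_U : ∀ j ≤ M, ‖U j‖ ≤ 1
  norm_P : ∀ j ≤ M, ‖P j‖ ≤ 1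
  norm_Q : ∀ j ≤ M, ‖1 - P j‖ ≤ 1
  idem : ∀ j ≤ M, P j * P j = P j
  comm : ∀ j ≤ M, U j * P j = P j * U j
  gap : ∀ j ≤ M, SpectralGap (U j) (P j) γ
  diff_U : ∀ j, j + 1 ≤ M → ‖fdiff U j‖ ≤ γ * ρ
  diff_two_U : ∀ j, j + 2 ≤ M → ‖fdiff (fdiff U) j‖ ≤ γ * ρ ^ 2
  diff_three_U : ∀ j, j + 3 ≤ M → ‖fdiff (fdiff (fdiff U)) j‖ ≤ γ * ρ ^ 3
  diff_P : ∀ j, j + 1 ≤ M → ‖fdiff P j‖ ≤ ρ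

theorem norm_comm_le {a b : ℝ} {X Y : B} (hX : ‖X‖ ≤ a) (hY : ‖Y‖ ≤ b) :
    ‖X * Y - Y * X‖ ≤ 2 * (a * b) := by
  have ha : 0 ≤ a := (norm_nonneg _).trans hX
  have h1 : ‖X * Y‖ ≤ a * b :=
    (norm_mul_le _ _).trans (mul_le_mul hX hY (norm_nonneg _) ha)
  have h2 : ‖Y * X‖ ≤ a * b := by
    rw [mul_comm a b]
    exact (norm_mul_le _ _).trans (mul_le_mul hY hX (norm_nonneg _) ((norm_nonneg _).trans hY))
  linarith [norm_sub_le (X * Y) (Y * X)]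

theorem norm_mul_le_of_le' {a b : ℝ} {X Y : B} (hX : ‖X‖ ≤ a) (hY : ‖Y‖ ≤ b) :
    ‖X * Y‖ ≤ a * b :=
  (norm_mul_le _ _).trans (mul_le_mul hX hY (norm_nonneg _) ((norm_nonneg _).trans hX))

/-- Off-diagonal blocks are controlled by the commutator with `U`, diagonal ones by the failure of
the derivation identity of a variation of an idempotent. -/
theorem SpectralGap.norm_le {U P : B} (hγ : 0 < γ) (h : SpectralGap U P γ) (hP : ‖P‖ ≤ 1)
    (hQ : ‖1 - P‖ ≤ 1) (hi : P * P = P) (D : B) {a b : ℝ} (ha : ‖U * D - D * U‖ ≤ γ * a)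
    (hb : ‖D - P * D - D * P‖ ≤ b) : ‖D‖ ≤ 2 * a + 2 * b := by
  have e : D = (1 - P) * D * P + P * D * (1 - P) - P * (D - P * D - D * P) * P
      + (1 - P) * (D - P * D - D * P) * (1 - P) := by
    simp only [mul_sub, sub_mul, mul_one, one_mul, ← mul_assoc, hi]
    simp only [mul_assoc, hi]
    abel
  have hb0 := (norm_nonneg _).trans hb
  have h1 : ‖(1 - P) * D * P‖ ≤ a :=
    le_of_mul_le_mul_left ((h.norm_lower_le D).trans ha) hγ
  have h2 : ‖P * D * (1 - P)‖ ≤ a :=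
    le_of_mul_le_mul_left ((h.norm_upper_le D).trans ha) hγ
  have h3 : ‖P * (D - P * D - D * P) * P‖ ≤ b := by
    simpa using norm_mul_le_of_le' (norm_mul_le_of_le' hP hb) hP
  have h4 : ‖(1 - P) * (D - P * D - D * P) * (1 - P)‖ ≤ b := by
    simpa using norm_mul_le_of_le' (norm_mul_le_of_le' hQ hb) hQ
  calc ‖D‖ = _ := congrArg norm e
    _ ≤ ‖(1 - P) * D * P‖ + ‖P * D * (1 - P)‖ + ‖P * (D - P * D - D * P) * P‖
      + ‖(1 - P) * (D - P * D - D * P) * (1 - P)‖ :=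
        (norm_add_le _ _).trans (add_le_add_left ((norm_sub_le _ _).trans
          (add_le_add_left (norm_add_le _ _) _)) _)
    _ ≤ 2 * a + 2 * b := by linarith

/-- The same for an element that is nearly lower triangular. -/
theorem SpectralGap.norm_le' {U P : B} (hγ : 0 < γ) (h : SpectralGap U P γ)
    (hQ : ‖1 - P‖ ≤ 1) (D : B) {a b d : ℝ} (ha : ‖U * D - D * U‖ ≤ γ * a)
    (hb : ‖P * D‖ ≤ b) (hd : ‖D * (1 - P)‖ ≤ d) : ‖D‖ ≤ a + b + d := by
  have e : D = (1 - P) * D * P + P * D + (1 - P) * (D * (1 - P)) := by noncomm_ring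
  have hd0 := (norm_nonneg _).trans hd
  have h1 : ‖(1 - P) * D * P‖ ≤ a :=
    le_of_mul_le_mul_left ((h.norm_lower_le D).trans ha) hγ
  have h4 : ‖(1 - P) * (D * (1 - P))‖ ≤ d := by
    simpa using norm_mul_le_of_le' hQ hd
  calc ‖D‖ = _ := congrArg norm e
    _ ≤ ‖(1 - P) * D * P‖ + ‖P * D‖ + ‖(1 - P) * (D * (1 - P))‖ :=
        (norm_add_le _ _).trans (add_le_add_left (norm_add_le _ _) _)
    _ ≤ a + b + d := by linarith

end Differences

/-! ### Differences of the projections, and the almost invariant tilted ranges -/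

section Correction

variable {B : Type*} [NormedRing B] {M N m n : ℕ} {γ ρ c : ℝ} {U P Y F : ℕ → B}

namespace GappedSequence

theorem tail (h : GappedSequence (M + 1) γ ρ U P) :
    GappedSequence M γ ρ (fun j => U (j + 1)) (fun j => P (j + 1)) where
  γ_pos := h.γ_pos
  γ_le := h.γ_le
  ρ_nonneg := h.ρ_nonneg
  ρ_le := h.ρ_le
  norm_U j hj := h.norm_U _ (by omega)
  norm_P j hj := h.norm_P _ (by omega)
  norm_Q j hj := h.norm_Q _ (by omega)
  idem j hj := h.idem _ (by omega)
  comm j hj := h.comm _ (by omega)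
  gap j hj := h.gap _ (by omega)
  diff_U j hj := h.diff_U (j + 1) (by omega)
  diff_two_U j hj := h.diff_two_U (j + 1) (by omega)
  diff_three_U j hj := h.diff_three_U (j + 1) (by omega)
  diff_P j hj := h.diff_P (j + 1) (by omega)

/-- Differencing `U P = P U` twice expresses the commutator of `U j` with `Δ²P` through lower
differences of `P`, and differencing `P P = P` does the same for the diagonal blocks of `Δ²P`;
`SpectralGap.norm_le` combines the two. The Leibniz rule leaves `Δ²P j * P (j + 2)` instead of `Δ²P
j * P j`. The discrepancy is a product of a crude bound on `Δ²P j`, one order too weak, and `P (j +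
2) - P j`, which supplies the missing `ρ`. `diff_three_P` repeats this one order higher. -/
theorem diff_two_P (h : GappedSequence M γ ρ U P) {j : ℕ} (hj : j + 2 ≤ M) :
    ‖fdiff (fdiff P) j‖ ≤ 24 * ρ ^ 2 := by
  have hγ := h.γ_pos
  have hρ := h.ρ_nonneg
  have hD : ‖fdiff (fdiff P) j‖ ≤ 2 * ρ := by
    have := norm_sub_le (fdiff P (j + 1)) (fdiff P j)
    have h1 := h.diff_P (j + 1) (by omega)
    have h2 := h.diff_P j (by omega)
    exact this.trans (by linarith)
  have hP2 : ‖P (j + 2) - P j‖ ≤ 2 * ρ := by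
    have e : P (j + 2) - P j = fdiff P (j + 1) + fdiff P j := by simp only [fdiff]; abel
    rw [e]
    refine (norm_add_le _ _).trans ?_
    have h1 := h.diff_P (j + 1) (by omega)
    have h2 := h.diff_P j (by omega)
    linarith
  have e1 : U j * fdiff (fdiff P) j - fdiff (fdiff P) j * U j
      = -((fdiff U j * fdiff P (j + 1) - fdiff P (j + 1) * fdiff U j)
        + (fdiff U j * fdiff P (j + 1) - fdiff P (j + 1) * fdiff U j)
        + (fdiff (fdiff U) j * P (j + 2) - P (j + 2) * fdiff (fdiff U) j)) := by
    have c0 := h.comm j (by omega)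
    have c1 := h.comm (j + 1) (by omega)
    have c2 := h.comm (j + 2) (by omega)
    simp only [fdiff, mul_sub, sub_mul, add_assoc, Nat.reduceAdd, c0, c1, c2]
    abel
  have e2 : fdiff (fdiff P) j - P j * fdiff (fdiff P) j - fdiff (fdiff P) j * P j
      = fdiff P j * fdiff P (j + 1) + fdiff P j * fdiff P (j + 1)
        + fdiff (fdiff P) j * (P (j + 2) - P j) := by
    have c0 := h.idem j (by omega)
    have c1 := h.idem (j + 1) (by omega)
    have c2 := h.idem (j + 2) (by omega)
    simp only [fdiff, mul_sub, sub_mul, add_assoc, Nat.reduceAdd, c0, c1, c2]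
    abel
  have b1 : ‖U j * fdiff (fdiff P) j - fdiff (fdiff P) j * U j‖ ≤ γ * (6 * ρ ^ 2) := by
    rw [e1, norm_neg]
    have k1 := norm_comm_le (h.diff_U j (by omega)) (h.diff_P (j + 1) (by omega))
    have k2 := norm_comm_le (h.diff_two_U j hj) (h.norm_P (j + 2) hj)
    refine (norm_add₃_le).trans ?_
    linarith
  have b2 : ‖fdiff (fdiff P) j - P j * fdiff (fdiff P) j - fdiff (fdiff P) j * P j‖
      ≤ 6 * ρ ^ 2 := by
    rw [e2]
    have k1 := norm_mul_le_of_le' (h.diff_P j (by omega)) (h.diff_P (j + 1) (by omega))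
    have k2 := norm_mul_le_of_le' hD hP2
    refine (norm_add₃_le).trans ?_
    linarith
  have := (h.gap j (by omega)).norm_le hγ (h.norm_P j (by omega)) (h.norm_Q j (by omega))
    (h.idem j (by omega)) _ b1 b2
  linarith

theorem diff_three_P (h : GappedSequence M γ ρ U P) {j : ℕ} (hj : j + 3 ≤ M) :
    ‖fdiff (fdiff (fdiff P)) j‖ ≤ 880 * ρ ^ 3 := by
  have hγ := h.γ_pos
  have hρ := h.ρ_nonneg
  have hD : ‖fdiff (fdiff (fdiff P)) j‖ ≤ 48 * ρ ^ 2 := by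
    have := norm_sub_le (fdiff (fdiff P) (j + 1)) (fdiff (fdiff P) j)
    have h1 := h.diff_two_P (j := j + 1) (by omega)
    have h2 := h.diff_two_P (j := j) (by omega)
    exact this.trans (by linarith)
  have hP3 : ‖P (j + 3) - P j‖ ≤ 3 * ρ := by
    have e : P (j + 3) - P j = fdiff P (j + 2) + fdiff P (j + 1) + fdiff P j := by
      simp only [fdiff]; abel
    rw [e]
    refine (norm_add₃_le).trans ?_
    have h1 := h.diff_P (j + 1) (by omega)
    have h2 := h.diff_P j (by omega)
    have h3 := h.diff_P (j + 2) (by omega)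
    linarith
  have e1 : U j * fdiff (fdiff (fdiff P)) j - fdiff (fdiff (fdiff P)) j * U j
      = -(3 • (fdiff U j * fdiff (fdiff P) (j + 1) - fdiff (fdiff P) (j + 1) * fdiff U j)
        + 3 • (fdiff (fdiff U) j * fdiff P (j + 2) - fdiff P (j + 2) * fdiff (fdiff U) j)
        + (fdiff (fdiff (fdiff U)) j * P (j + 3) - P (j + 3) * fdiff (fdiff (fdiff U)) j)) := by
    have c0 := h.comm j (by omega)
    have c1 := h.comm (j + 1) (by omega)
    have c2 := h.comm (j + 2) (by omega)
    have c3 := h.comm (j + 3) (by omega)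
    simp only [fdiff, mul_sub, sub_mul, add_assoc, Nat.reduceAdd, c0, c1, c2, c3]
    abel
  have e2 : fdiff (fdiff (fdiff P)) j - P j * fdiff (fdiff (fdiff P)) j
        - fdiff (fdiff (fdiff P)) j * P j
      = 3 • (fdiff P j * fdiff (fdiff P) (j + 1)) + 3 • (fdiff (fdiff P) j * fdiff P (j + 2))
        + fdiff (fdiff (fdiff P)) j * (P (j + 3) - P j) := by
    have c0 := h.idem j (by omega)
    have c1 := h.idem (j + 1) (by omega)
    have c2 := h.idem (j + 2) (by omega)
    have c3 := h.idem (j + 3) (by omega)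
    simp only [fdiff, mul_sub, sub_mul, add_assoc, Nat.reduceAdd, c0, c1, c2, c3]
    abel
  have three : ∀ x : B, ‖3 • x‖ ≤ 3 * ‖x‖ := fun x => by
    simpa using norm_nsmul_le (n := 3) (a := x)
  have b1 : ‖U j * fdiff (fdiff (fdiff P)) j - fdiff (fdiff (fdiff P)) j * U j‖
      ≤ γ * (152 * ρ ^ 3) := by
    rw [e1, norm_neg]
    have k1 := norm_comm_le (h.diff_U j (by omega)) (h.diff_two_P (j := j + 1) (by omega))
    have k2 := norm_comm_le (h.diff_two_U j (by omega)) (h.diff_P (j + 2) (by omega))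
    have k3 := norm_comm_le (h.diff_three_U j hj) (h.norm_P (j + 3) hj)
    refine (norm_add₃_le).trans ?_
    refine (add_le_add (add_le_add (three _) (three _)) le_rfl).trans ?_
    linarith
  have b2 : ‖fdiff (fdiff (fdiff P)) j - P j * fdiff (fdiff (fdiff P)) j
        - fdiff (fdiff (fdiff P)) j * P j‖ ≤ 288 * ρ ^ 3 := by
    rw [e2]
    have k1 := norm_mul_le_of_le' (h.diff_P j (by omega)) (h.diff_two_P (j := j + 1) (by omega))
    have k2 := norm_mul_le_of_le' (h.diff_two_P (j := j) (by omega)) (h.diff_P (j + 2) (by omega))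
    have k3 := norm_mul_le_of_le' hD hP3
    refine (norm_add₃_le).trans ?_
    refine (add_le_add (add_le_add (three _) (three _)) le_rfl).trans ?_
    linarith
  have := (h.gap j (by omega)).norm_le hγ (h.norm_P j (by omega)) (h.norm_Q j (by omega))
    (h.idem j (by omega)) _ b1 b2
  linarith

theorem diffBound_U (h : GappedSequence M γ ρ U P) : DiffBound ρ M 0 0 3 2 U := by
  have hγ := h.γ_le
  have hρ := h.ρ_nonneg
  intro k hk j hj
  interval_cases k
  · simpa using (h.norm_U j (by omega)).trans (by norm_num)
  · exact (h.diff_U j (by omega)).trans (by simp only [zero_add, pow_one]; gcongr)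
  · exact (h.diff_two_U j (by omega)).trans (by simp only [zero_add]; gcongr)
  · exact (h.diff_three_U j (by omega)).trans (by simp only [zero_add]; gcongr)

theorem diffBound_P_two (h : GappedSequence M γ ρ U P) : DiffBound ρ M 0 0 2 24 P := by
  have hρ := h.ρ_nonneg
  intro k hk j hj
  interval_cases k
  · simpa using (h.norm_P j (by omega)).trans (by norm_num)
  · exact (h.diff_P j (by omega)).trans (by simp only [zero_add, pow_one]; linarith)
  · exact h.diff_two_P (by omega)

theorem diffBound_Q_two (h : GappedSequence M γ ρ U P) :
    DiffBound ρ M 0 0 2 24 (fun j => 1 - P j) := by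
  have e : fdiff (fun j => 1 - P j) = fun j => - fdiff P j := by
    funext j; simp only [fdiff]; abel
  have e' : fdiff (fun j => - fdiff P j) = fun j => - fdiff (fdiff P) j := by
    funext j; simp only [fdiff]; abel
  have hP := h.diffBound_P_two
  intro k hk j hj
  interval_cases k
  · simpa using (h.norm_Q j (by omega)).trans (by norm_num)
  · simp only [Function.iterate_one, e, norm_neg]
    exact hP 1 (by omega) j hj
  · simp only [Function.iterate_succ_apply, Function.iterate_zero_apply, e, e', norm_neg]
    exact hP 2 (by omega) j hj

theorem diffBound_fdiff_P (h : GappedSequence M γ ρ U P) :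
    DiffBound ρ M 1 1 2 880 (fdiff P) := by
  have hρ := h.ρ_nonneg
  refine DiffBound.fdiff (n := 2) (m := 0) (r := 0) (F := P) ?_
  intro k hk j hj
  interval_cases k
  · simpa using (h.norm_P j (by omega)).trans (by norm_num)
  · exact (h.diff_P j (by omega)).trans (by simp only [zero_add, pow_one]; linarith)
  · exact (h.diff_two_P (by omega)).trans (by simp only [zero_add]; gcongr; norm_num)
  · exact h.diff_three_P (by omega)

/-- Differences of the solutions of the commutator equation `[U, Y] = F`. -/
theorem diffBound_solution (h : GappedSequence M γ ρ U P) (hc : 0 ≤ c) (hn : n ≤ 2)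
    (hPY : ∀ j ≤ M, P j * Y j = 0) (hYP : ∀ j ≤ M, Y j * P j = Y j)
    (hUY : ∀ j ≤ M, U j * Y j - Y j * U j = F j) (hF : DiffBound ρ M 0 m n c F) :
    DiffBound ρ M 0 m n (100 * c / γ) Y := by
  have hγ := h.γ_pos
  have hρ := h.ρ_nonneg
  have zero : ∀ j ≤ M, ‖Y j‖ ≤ c / γ * ρ ^ m := by
    intro j hj
    have := (h.gap j hj).norm_le' hγ (h.norm_Q j hj) (Y j) (a := c / γ * ρ ^ m) (b := 0) (d := 0)
      (by
        rw [hUY j hj]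
        refine (hF.norm_le (by omega)).trans (le_of_eq ?_)
        field_simp)
      (by simp [hPY j hj]) (by simp [mul_sub, hYP j hj])
    simpa using this
  -- Differencing the three equations `U Y - Y U = F`, `P Y = 0`, `Y P = Y` controls, in turn, the
  -- lower block of `ΔY`, the part `P ΔY` and the part `ΔY (1 - P)`. Each difference gains `ρ`
  -- without a further `1/γ`, because `ΔU` carries a factor `γ`.
  have one : 1 ≤ n → ∀ j, j + 1 ≤ M → ‖fdiff Y j‖ ≤ 5 * (c / γ) * ρ ^ (m + 1) := by
    intro hn1 j hj
    have hY1 := zero (j + 1) hj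
    have hP := h.diff_P j hj
    have := (h.gap j (by omega)).norm_le' hγ (h.norm_Q j (by omega)) (fdiff Y j)
      (a := 3 * (c / γ) * ρ ^ (m + 1)) (b := (c / γ) * ρ ^ (m + 1)) (d := (c / γ) * ρ ^ (m + 1))
      (by
        have e : U j * fdiff Y j - fdiff Y j * U j
            = fdiff F j - (fdiff U j * Y (j + 1) - Y (j + 1) * fdiff U j) := by
          simp only [fdiff, ← hUY j (by omega), ← hUY (j + 1) hj, mul_sub, sub_mul]
          abel
        rw [e]
        have k1 := hF.norm_fdiff_le hn1 (j := j) (by omega)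
        have k2 := norm_comm_le (h.diff_U j hj) hY1
        refine (norm_sub_le _ _).trans ((add_le_add k1 k2).trans (le_of_eq ?_))
        field_simp
        ring)
      (by
        have e : P j * fdiff Y j = - (fdiff P j * Y (j + 1)) := by
          simp only [fdiff, mul_sub, sub_mul, hPY j (by omega), hPY (j + 1) hj]
          abel
        rw [e, norm_neg]
        refine (norm_mul_le_of_le' hP hY1).trans (le_of_eq (by ring)))
      (by
        have e : fdiff Y j * (1 - P j) = Y (j + 1) * fdiff P j := by
          simp only [fdiff, mul_sub, sub_mul, hYP j (by omega), hYP (j + 1) hj, mul_one]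
          abel
        rw [e]
        refine (norm_mul_le_of_le' hY1 hP).trans (le_of_eq (by ring)))
    linarith
  have two : 2 ≤ n → ∀ j, j + 2 ≤ M → ‖fdiff (fdiff Y) j‖ ≤ 100 * (c / γ) * ρ ^ (m + 2) := by
    intro hn2 j hj
    have hY1 := one (by omega) (j + 1) (by omega)
    have hY2 := zero (j + 2) (by omega)
    have hP := h.diff_P j (by omega)
    have hP2 := h.diff_two_P hj
    have := (h.gap j (by omega)).norm_le' hγ (h.norm_Q j (by omega)) (fdiff (fdiff Y) j)
      (a := 23 * (c / γ) * ρ ^ (m + 2)) (b := 34 * (c / γ) * ρ ^ (m + 2))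
      (d := 34 * (c / γ) * ρ ^ (m + 2))
      (by
        have e : U j * fdiff (fdiff Y) j - fdiff (fdiff Y) j * U j
            = fdiff (fdiff F) j - ((fdiff U j * fdiff Y (j + 1) - fdiff Y (j + 1) * fdiff U j)
              + (fdiff U j * fdiff Y (j + 1) - fdiff Y (j + 1) * fdiff U j)
              + (fdiff (fdiff U) j * Y (j + 2) - Y (j + 2) * fdiff (fdiff U) j)) := by
          simp only [fdiff, ← hUY j (by omega), ← hUY (j + 1) (by omega),
            ← hUY (j + 2) (by omega), mul_sub, sub_mul, add_assoc, Nat.reduceAdd]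
          abel
        rw [e]
        have k1 := hF.norm_fdiff_two_le hn2 (j := j) (by omega)
        have k2 := norm_comm_le (h.diff_U j (by omega)) hY1
        have k3 := norm_comm_le (h.diff_two_U j hj) hY2
        refine (norm_sub_le _ _).trans ((add_le_add k1 (norm_add₃_le.trans
          (add_le_add (add_le_add k2 k2) k3))).trans (le_of_eq ?_))
        field_simp
        ring)
      (by
        have e : P j * fdiff (fdiff Y) j = - (fdiff P j * fdiff Y (j + 1)
            + fdiff P j * fdiff Y (j + 1) + fdiff (fdiff P) j * Y (j + 2)) := by
          simp only [fdiff, mul_sub, sub_mul, hPY j (by omega), hPY (j + 1) (by omega),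
            hPY (j + 2) (by omega), add_assoc, Nat.reduceAdd]
          abel
        rw [e, norm_neg]
        refine norm_add₃_le.trans ((add_le_add (add_le_add (norm_mul_le_of_le' hP hY1)
          (norm_mul_le_of_le' hP hY1)) (norm_mul_le_of_le' hP2 hY2)).trans (le_of_eq (by ring))))
      (by
        have e : fdiff (fdiff Y) j * (1 - P j) = fdiff Y (j + 1) * fdiff P j
            + fdiff Y (j + 1) * fdiff P j + Y (j + 2) * fdiff (fdiff P) j := by
          simp only [fdiff, mul_sub, sub_mul, hYP j (by omega), hYP (j + 1) (by omega),
            hYP (j + 2) (by omega), mul_one, add_assoc, Nat.reduceAdd]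
          abel
        rw [e]
        refine norm_add₃_le.trans ((add_le_add (add_le_add (norm_mul_le_of_le' hY1 hP)
          (norm_mul_le_of_le' hY1 hP)) (norm_mul_le_of_le' hY2 hP2)).trans (le_of_eq (by ring))))
    have h0 : 0 ≤ c / γ * ρ ^ (m + 2) := by positivity
    linarith
  intro k hk j hj
  have hcγ : 0 ≤ c / γ := by positivity
  rw [mul_div_assoc]
  have hk2 : k ≤ 2 := hk.trans hn
  interval_cases k
  · have := zero j (by omega)
    have h0 : 0 ≤ c / γ * ρ ^ m := by positivity
    simp only [Function.iterate_zero_apply, add_zero]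
    linarith
  · have := one hk j (by omega)
    have h0 : 0 ≤ c / γ * ρ ^ (m + 1) := by positivity
    simp only [Function.iterate_one]
    linarith
  · exact two hk j (by omega)

/-- There are `X j`, off-diagonal with respect to `P (j + 2)`, such that the graphs of
`X j : range (P (j + 2)) → range (1 - P (j + 2))` are nearly invariant under the steps `U`. -/
theorem exists_correction (h : GappedSequence (N + 2) γ ρ U P) :
    ∃ X : ℕ → B, (∀ j ≤ N, P (j + 2) * X j = 0) ∧ (∀ j ≤ N, X j * P (j + 2) = X j) ∧
      (∀ j ≤ N, ‖X j‖ ≤ 10 ^ 17 * (ρ / γ)) ∧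
      (∀ j ≤ N, ∀ γ' > 0, SpectralGap (U (j + 2)) (P (j + 2)) γ' →
        ‖X j‖ ≤ ‖P (j + 2) - P (j + 1)‖ / γ' + 10 ^ 16 * (ρ / γ) ^ 2) ∧
      (∀ j, j + 1 ≤ N →
        ‖(1 - P (j + 3) - X (j + 1)) * U (j + 3) * (P (j + 2) + X j)‖
          ≤ 10 ^ 36 * ρ * (ρ / γ) ^ 2) := by
  have hγ := h.γ_pos
  have hγ2 := h.γ_le
  have hρ := h.ρ_nonneg
  have h1 := h.tail
  have h2 := h1.tail
  have commQ : ∀ j ≤ N + 2, U j * (1 - P j) = (1 - P j) * U j := fun j hj => by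
    simp [mul_sub, sub_mul, h.comm j hj]
  have exY : ∀ j, ∃ Y, j ≤ N + 1 → P (j + 1) * Y = 0 ∧ Y * P (j + 1) = Y ∧
      U (j + 1) * Y - Y * U (j + 1) = U (j + 1) * (1 - P (j + 1)) * fdiff P j * P (j + 1) := by
    intro j
    by_cases hj : j ≤ N + 1
    · obtain ⟨Y, a, b, d⟩ := (h.gap (j + 1) (by omega)).exists_solution (U (j + 1) * fdiff P j)
      refine ⟨Y, fun _ => ⟨a, b, ?_⟩⟩
      rw [d, commQ (j + 1) (by omega)]
      simp only [mul_assoc]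
    · exact ⟨0, fun h => absurd h hj⟩
  choose Y hY using exY
  have bP := h.diffBound_P_two
  have bQ := h.diffBound_Q_two
  have bU : DiffBound ρ (N + 2) 0 0 2 2 U := h.diffBound_U.mono (by norm_num) le_rfl hρ le_rfl
  have boundF : DiffBound ρ (N + 1) 0 1 2 (10 ^ 8)
      (fun j => U (j + 1) * (1 - P (j + 1)) * fdiff P j * P (j + 1)) := by
    have := ((bU.mul hρ (by norm_num) bQ).shift.mul hρ (by norm_num) h.diffBound_fdiff_P).mul
      hρ (by norm_num) bP.shift
    intro k hk j hj
    refine (this k hk j (by omega)).trans ?_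
    simp only [zero_add, add_zero]
    gcongr
    norm_num
  have boundY := h1.diffBound_solution (by norm_num) le_rfl (fun j hj => (hY j hj).1)
    (fun j hj => (hY j hj).2.1) (fun j hj => (hY j hj).2.2) boundF
  -- Second-order tilt: the same equation, with the change of `Y` in place of the change of `P`.
  have exZ : ∀ j, ∃ Z, j ≤ N → P (j + 2) * Z = 0 ∧ Z * P (j + 2) = Z ∧
      U (j + 2) * Z - Z * U (j + 2) = U (j + 2) * (1 - P (j + 2)) * fdiff Y j * P (j + 2) := by
    intro j
    by_cases hj : j ≤ N
    · obtain ⟨Y, a, b, d⟩ := (h.gap (j + 2) (by omega)).exists_solution (U (j + 2) * fdiff Y j)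
      refine ⟨Y, fun _ => ⟨a, b, ?_⟩⟩
      rw [d, commQ (j + 2) (by omega)]
      simp only [mul_assoc]
    · exact ⟨0, fun h => absurd h hj⟩
  choose Z hZ using exZ
  have boundG : DiffBound ρ N 0 2 1 (10 ^ 14 / γ)
      (fun j => U (j + 2) * (1 - P (j + 2)) * fdiff Y j * P (j + 2)) := by
    have bU1 : DiffBound ρ (N + 2) 0 0 1 2 U := bU.mono (by norm_num) le_rfl hρ le_rfl
    have bP1 : DiffBound ρ (N + 2) 0 0 1 24 P := bP.mono (by norm_num) le_rfl hρ le_rfl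
    have bQ1 : DiffBound ρ (N + 2) 0 0 1 24 (fun j => 1 - P j) :=
      bQ.mono (by norm_num) le_rfl hρ le_rfl
    have bY1 : DiffBound ρ (N + 2) 2 2 1 (100 * 10 ^ 8 / γ) (fdiff Y) := fun k hk j hj =>
      boundY.fdiff k hk j (by omega)
    have := ((bU1.mul hρ (by norm_num) bQ1).shift.shift.mul hρ (by norm_num) bY1).mul
      hρ (by positivity) bP1.shift.shift
    intro k hk j hj
    refine (this k hk j (by omega)).trans ?_
    simp only [zero_add, add_zero]
    gcongr ?_ * _
    rw [le_div_iff₀ hγ]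
    field_simp
    norm_num
  have boundZ := h2.diffBound_solution (by positivity) (by norm_num) (fun j hj => (hZ j hj).1)
    (fun j hj => (hZ j hj).2.1) (fun j hj => (hZ j hj).2.2) boundG
  have hρ1 : ρ / γ ≤ 1 := (div_le_one hγ).2 h.ρ_le
  have hργ : 0 ≤ ρ / γ := by positivity
  have nY : ∀ j ≤ N + 1, ‖Y j‖ ≤ 10 ^ 10 * (ρ / γ) := fun j hj =>
    (boundY.norm_le (j := j) (by omega)).trans (le_of_eq (by field_simp; norm_num))
  have nZ : ∀ j ≤ N, ‖Z j‖ ≤ 10 ^ 16 * (ρ / γ) ^ 2 := fun j hj =>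
    (boundZ.norm_le (j := j) (by omega)).trans (le_of_eq (by field_simp; norm_num))
  have ndY : ∀ j ≤ N, ‖fdiff Y j‖ ≤ 10 ^ 10 * (ρ / γ * ρ) := fun j hj =>
    (boundY.norm_fdiff_le (by norm_num) (j := j) (by omega)).trans
      (le_of_eq (by field_simp; norm_num))
  have ndZ : ∀ j, j + 1 ≤ N → ‖fdiff Z j‖ ≤ 10 ^ 16 * (ρ * (ρ / γ) ^ 2) := fun j hj =>
    (boundZ.norm_fdiff_le (by norm_num) (j := j) (by omega)).trans
      (le_of_eq (by field_simp; norm_num))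
  have nX : ∀ j ≤ N, ‖Y (j + 1) + Z j‖ ≤ 10 ^ 17 * (ρ / γ) := fun j hj => by
    have k1 := nY (j + 1) (by omega)
    have k2 := nZ j hj
    have k3 : (ρ / γ) ^ 2 ≤ ρ / γ := by nlinarith
    refine (norm_add_le _ _).trans ?_
    linarith
  refine ⟨fun j => Y (j + 1) + Z j, fun j hj => ?_, fun j hj => ?_, nX, fun j hj γ' hγ' hg => ?_,
    fun j hj => ?_⟩
  · rw [mul_add, (hZ j hj).1, (hY (j + 1) (by omega)).1, add_zero]
  · rw [add_mul, (hZ j hj).2.1, (hY (j + 1) (by omega)).2.1]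
  -- Only `Y` is of first order, so only `Y` is estimated with the gap `γ'` of this particular step;
  -- the uniform `γ` is good enough for `Z`. This is what brings the endpoint gaps into the final
  -- bound.
  · refine (norm_add_le _ _).trans (add_le_add ?_ (nZ j hj))
    obtain ⟨a, b, d⟩ := hY (j + 1) (by omega)
    have k := hg.norm_lower_le (Y (j + 1))
    rw [sub_mul, a, one_mul, sub_zero, b, d] at k
    rw [le_div_iff₀ hγ', mul_comm]
    refine k.trans ?_
    have := norm_mul_le_of_le' (norm_mul_le_of_le' (norm_mul_le_of_le' (h.norm_U (j + 2) (by omega))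
      (h.norm_Q (j + 2) (by omega))) (le_refl ‖fdiff P (j + 1)‖)) (h.norm_P (j + 2) (by omega))
    simpa [fdiff] using this
  · obtain ⟨a, b, d⟩ := hY (j + 1) (by omega)
    obtain ⟨a', b', d'⟩ := hY (j + 2) (by omega)
    obtain ⟨x, y, z⟩ := hZ j (by omega)
    obtain ⟨x', y', z'⟩ := hZ (j + 1) (by omega)
    have nx := nX j (by omega)
    have nx' := nX (j + 1) (by omega)
    have ndp := h.diff_P (j + 2) (by omega)
    have ndy := ndY (j + 1) (by omega)
    have ndz := ndZ j hj
    have nu := h.norm_U (j + 3) (by omega)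
    have nQ := h.norm_Q (j + 3) (by omega)
    have np := h.norm_P (j + 2) (by omega)
    have cu := h.comm (j + 3) (by omega)
    have ip := h.idem (j + 2) (by omega)
    have iP := h.idem (j + 3) (by omega)
    simp only [fdiff, add_assoc, Nat.reduceAdd] at d d' z z' ndp ndy ndz a a' b b' x x' y y' nx nx'
    simp only [add_assoc, Nat.reduceAdd]
    generalize hx : Y (j + 1) + Z j = xx at *
    generalize hX : Y (j + 2) + Z (j + 1) = XX at *
    have px : P (j + 2) * xx = 0 := by rw [← hx, mul_add, a, x, add_zero]
    have xp : xx * P (j + 2) = xx := by rw [← hx, add_mul, b, y]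
    have PX : P (j + 3) * XX = 0 := by rw [← hX, mul_add, a', x', add_zero]
    have XP : XX * P (j + 3) = XX := by rw [← hX, add_mul, b', y']
    have eqX : U (j + 3) * XX - XX * U (j + 3)
        = U (j + 3) * (1 - P (j + 3)) * (P (j + 3) - P (j + 2)) * P (j + 3)
          + U (j + 3) * (1 - P (j + 3)) * (Y (j + 2) - Y (j + 1)) * P (j + 3) := by
      rw [← d', ← z', ← hX]
      noncomm_ring
    have hdx : XX - xx = (Y (j + 2) - Y (j + 1)) + (Z (j + 1) - Z j) := by
      rw [← hX, ← hx]; abel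
    generalize Y (j + 2) - Y (j + 1) = dy at *
    generalize Z (j + 1) - Z j = dz at *
    generalize U (j + 3) = u at *
    generalize P (j + 3) = P' at *
    generalize P (j + 2) = p at *
    -- The residual is the defect of the Riccati equation for an invariant graph. The equations of
    -- `Y` and `Z` cancel its terms of first and second order. What survives has third order: the
    -- products arising from `P'` standing where `p` should, the change `dz` of `Z`, and the
    -- quadratic term `XX * u * (P' - p) * xx`.
    have e : (1 - P' - XX) * u * (p + xx)
        = u * ((1 - P') * (P' - p)) * ((P' - p) * (1 - P')) * (-((1 - P') * (P' - p)))
          - u * ((1 - P') * dy) * (-((1 - P') * (P' - p)))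
          - u * ((1 - P') * dz) * p - XX * u * (P' - p) * xx := by
      have e1 : (1 - P' - XX) * u * (p + xx)
          = (u * XX - XX * u - u * (1 - P') * (P' - p) - u * (1 - P') * (XX - xx)) * p
            - XX * u * (P' - p) * xx := by
        have cu' : P' * u = u * P' := cu.symm
        have a1 : ∀ t, P' * (P' * t) = P' * t := fun t => by rw [← mul_assoc, iP]
        have a3 : ∀ t, XX * (u * (P' * t)) = XX * (u * t) := fun t => by
          rw [← mul_assoc u, cu, ← mul_assoc, ← mul_assoc, XP, mul_assoc]
        have a4 : ∀ t, P' * (XX * t) = 0 := fun t => by rw [← mul_assoc, PX, zero_mul]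
        have a5 : ∀ t, P' * (u * t) = u * (P' * t) := fun t => by
          rw [← mul_assoc, cu', mul_assoc]
        simp only [mul_add, mul_sub, sub_mul, mul_one, one_mul, mul_assoc, px, xp, ip,
          a1, a3, a4, a5, mul_zero]
        abel
      have e2 : (u * XX - XX * u - u * (1 - P') * (P' - p) - u * (1 - P') * (XX - xx)) * p
          = - (u * ((1 - P') * (P' - p) * (1 - P')) * ((1 - P') * p))
          - u * ((1 - P') * dy) * ((1 - P') * p) - u * ((1 - P') * dz) * p := by
        have a1 : ∀ t, P' * (P' * t) = P' * t := fun t => by rw [← mul_assoc, iP]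
        rw [eqX, hdx]
        simp only [mul_add, add_mul, mul_sub, sub_mul, mul_one, one_mul, mul_assoc, a1, iP]
        abel
      have e3 : (1 - P') * p = -((1 - P') * (P' - p)) := by
        simp only [mul_sub, sub_mul, one_mul, iP]; abel
      -- The diagonal block of a difference of idempotents is quadratic in that difference; this
      -- supplies the extra order in the first term.
      have e4 : (1 - P') * (P' - p) * (1 - P')
          = -((1 - P') * (P' - p) * ((P' - p) * (1 - P'))) := by
        have a1 : ∀ t, P' * (P' * t) = P' * t := fun t => by rw [← mul_assoc, iP]
        have a2 : ∀ t, p * (p * t) = p * t := fun t => by rw [← mul_assoc, ip]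
        simp only [mul_sub, sub_mul, one_mul, mul_one, mul_assoc, iP, a2, ip]; abel
      rw [e1, e2, e3, e4]
      noncomm_ring
    rw [e]
    have m1 := norm_mul_le_of_le' nQ ndp
    have m2 := norm_mul_le_of_le' ndp nQ
    have m3 : ‖-((1 - P') * (P' - p))‖ ≤ 1 * ρ := by rwa [norm_neg]
    have t1 := norm_mul_le_of_le' (norm_mul_le_of_le' (norm_mul_le_of_le' nu m1) m2) m3
    have t2 := norm_mul_le_of_le' (norm_mul_le_of_le' nu (norm_mul_le_of_le' nQ ndy)) m3
    have t3 := norm_mul_le_of_le' (norm_mul_le_of_le' nu (norm_mul_le_of_le' nQ ndz)) np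
    have t4 := norm_mul_le_of_le' (norm_mul_le_of_le' (norm_mul_le_of_le' nx' nu) ndp) nx
    refine (norm_sub_le_of_le (norm_sub_le_of_le (norm_sub_le_of_le t1 t2) t3) t4).trans ?_
    have hr : ρ = γ * (ρ / γ) := by field_simp
    have i1 : ρ * ρ ≤ 2 * (ρ / γ * ρ) := by
      have : 0 ≤ ρ / γ * ρ := by positivity
      nlinarith
    have i2 : ρ / γ * ρ ≤ 2 * (ρ / γ) ^ 2 := by
      have : 0 ≤ (ρ / γ) ^ 2 := by positivity
      nlinarith
    have i3 := mul_le_mul_of_nonneg_left i1 hρ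
    have i4 := mul_le_mul_of_nonneg_left i2 hρ
    have i5 : 0 ≤ ρ * (ρ / γ) ^ 2 := by positivity
    nlinarith

end GappedSequence

end Correction

/-! ### Propagation of the deviation from the tilted range -/

section Dynamics

variable {V : Type*} [NormedAddCommGroup V] [NormedSpace ℂ V]

theorem discrete_gronwall {a : ℕ → ℝ} {b R : ℝ} {N : ℕ} (hb : 0 ≤ b) (hR : 0 ≤ R)
    (ha : 0 ≤ a 0) (h : ∀ j, j + 1 ≤ N → a (j + 1) ≤ R + (1 + b) * a j) (hbN : N * b ≤ 1) :
    a N ≤ 3 * (a 0 + N * R) := by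
  have key : ∀ j ≤ N, a j ≤ (1 + b) ^ j * (a 0 + j * R) := by
    intro j
    induction j with
    | zero => simp
    | succ j ih =>
      intro hj
      have h1 := ih (by omega)
      have h2 : 1 ≤ (1 + b) ^ (j + 1) := one_le_pow₀ (by linarith)
      calc a (j + 1) ≤ R + (1 + b) * a j := h j hj
        _ ≤ (1 + b) ^ (j + 1) * R + (1 + b) * ((1 + b) ^ j * (a 0 + j * R)) := by
          gcongr
          exact le_mul_of_one_le_left hR h2
        _ = (1 + b) ^ (j + 1) * (a 0 + (j + 1 : ℕ) * R) := by push_cast; ring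
  refine (key N le_rfl).trans ?_
  gcongr
  calc (1 + b) ^ N ≤ Real.exp b ^ N := by
        gcongr
        linarith [Real.add_one_le_exp b]
    _ = Real.exp (N * b) := by rw [← Real.exp_nat_mul]
    _ ≤ Real.exp 1 := Real.exp_le_exp.2 hbN
    _ ≤ 3 := by linarith [Real.exp_one_lt_d9]

/-- The transition amplitude out of the range of `P`, after all the steps of a gapped sequence. -/
theorem GappedSequence.norm_transition_le {N : ℕ} {γ ρ γ₀ γ₁ : ℝ} {U P : ℕ → V →L[ℂ] V}
    (h : GappedSequence (N + 2) γ ρ U P) (x : ℕ → V) (hx : ∀ j, x (j + 1) = U (j + 1) (x j))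
    (hx1 : ∀ j ≤ N + 2, ‖x j‖ ≤ 1) (h0 : P 0 (x 0) = x 0) (hγ₀ : 0 < γ₀)
    (hg₀ : SpectralGap (U 2) (P 2) γ₀) (hγ₁ : 0 < γ₁)
    (hg₁ : SpectralGap (U (N + 2)) (P (N + 2)) γ₁) (hN : N * (10 ^ 17 * (ρ / γ) * ρ) ≤ 1) :
    ‖(1 - P (N + 2)) (x (N + 2))‖ ≤ 3 * (‖P 1 - P 0‖ + ‖P 2 - P 1‖ + ‖P 2 - P 1‖ / γ₀)
      + ‖P (N + 2) - P (N + 1)‖ / γ₁ + 10 ^ 17 * (ρ / γ) ^ 2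
      + 3 * (N * (10 ^ 36 * ρ * (ρ / γ) ^ 2)) := by
  have hγ := h.γ_pos
  have hρ := h.ρ_nonneg
  obtain ⟨X, hPX, hXP, nX, nXb, nR⟩ := h.exists_correction
  have app : ∀ {a : ℝ} (T : V →L[ℂ] V) {v : V}, ‖v‖ ≤ a → ‖T v‖ ≤ ‖T‖ * a := fun T v hv =>
    (T.le_opNorm v).trans (by gcongr)
  -- The deviation of the state from the graph of `X j`. The index starts at `2` because `X j` is
  -- built from the changes of `P` over the two preceding steps.
  set y : ℕ → V := fun j => (1 - P (j + 2) - X j) (x (j + 2)) with hy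
  have step : ∀ j, j + 1 ≤ N → ‖y (j + 1)‖ ≤ 10 ^ 36 * ρ * (ρ / γ) ^ 2
      + (1 + 10 ^ 17 * (ρ / γ) * ρ) * ‖y j‖ := by
    intro j hj
    have ip := h.idem (j + 2) (by omega)
    have py : P (j + 2) (y j) = 0 := by
      have : P (j + 2) * (1 - P (j + 2) - X j) = 0 := by
        rw [mul_sub, mul_sub, mul_one, ip, hPX j (by omega), sub_self, sub_zero]
      exact congrArg (fun T : V →L[ℂ] V => T (x (j + 2))) this
    have e : y (j + 1) = ((1 - P (j + 3) - X (j + 1)) * U (j + 3) * (P (j + 2) + X j)) (x (j + 2))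
        + ((1 - P (j + 3)) (U (j + 3) (y j))
          - (X (j + 1) * U (j + 3) * (P (j + 3) - P (j + 2))) (y j)) := by
      -- As `y j` is killed by `P (j + 2)`, the tilt acts on it only through the change of `P`. So
      -- the growth factor per step is `1 + O(ρ²/γ)` and not `1 + O(ρ/γ)`, and by `hN` its product
      -- over all the steps stays bounded.
      have e1 : (X (j + 1) * U (j + 3) * (P (j + 3) - P (j + 2))) (y j)
          = X (j + 1) (U (j + 3) (y j)) := by
        have : X (j + 1) * U (j + 3) * P (j + 3) = X (j + 1) * U (j + 3) := by
          rw [mul_assoc, h.comm (j + 3) (by omega), ← mul_assoc, hXP (j + 1) hj]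
        rw [mul_sub, this, sub_apply, mul_apply_eq_comp,
          mul_apply_eq_comp (X (j + 1) * U (j + 3)), py, map_zero, sub_zero]
      have e2 : x (j + 2) = (P (j + 2) + X j) (x (j + 2)) + y j := by
        simp [hy]
      have e3 : x (j + 3) = U (j + 3) (x (j + 2)) := hx (j + 2)
      rw [e1]
      have : y (j + 1) = (1 - P (j + 3) - X (j + 1)) (U (j + 3) (x (j + 2))) := by
        simp only [hy, ← e3, add_assoc, Nat.reduceAdd]
      rw [this]
      conv_lhs => rw [e2]
      simp only [map_add, mul_apply_eq_comp, sub_apply]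
    rw [e]
    have k1 := app ((1 - P (j + 3) - X (j + 1)) * U (j + 3) * (P (j + 2) + X j))
      (hx1 (j + 2) (by omega))
    have k2 := app (1 - P (j + 3)) (app (U (j + 3)) (le_refl ‖y j‖))
    have k3 := app (X (j + 1) * U (j + 3) * (P (j + 3) - P (j + 2))) (le_refl ‖y j‖)
    have k4 := norm_mul_le_of_le' (norm_mul_le_of_le' (nX (j + 1) hj)
      (h.norm_U (j + 3) (by omega))) (h.diff_P (j + 2) (by omega))
    have k5 := nR j hj
    have k6 : ‖1 - P (j + 3)‖ * (‖U (j + 3)‖ * ‖y j‖) ≤ 1 * (1 * ‖y j‖) := by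
      gcongr
      · exact h.norm_Q _ (by omega)
      · exact h.norm_U _ (by omega)
    have k7 := mul_le_mul_of_nonneg_right k4 (norm_nonneg (y j))
    simp only [fdiff, add_assoc, Nat.reduceAdd] at k4 k7
    refine (norm_add_le_of_le k1 (norm_sub_le_of_le k2 k3)).trans ?_
    linarith
  have grow := discrete_gronwall (a := fun j => ‖y j‖) (by positivity) (by positivity)
    (norm_nonneg _) step hN
  -- The first two steps precede the tilt and are paid for directly by the motion of `P`.
  have start : ‖(1 - P 2) (x 2)‖ ≤ ‖P 1 - P 0‖ + ‖P 2 - P 1‖ := by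
    have cq : ∀ j ≤ N + 2, ∀ v, (1 - P j) (U j v) = U j ((1 - P j) v) := by
      intro j hj v
      have : (1 - P j) * U j = U j * (1 - P j) := by
        rw [sub_mul, mul_sub, one_mul, mul_one, h.comm j hj]
      exact congrArg (fun T : V →L[ℂ] V => T v) this
    have drop : ∀ j, j + 1 ≤ N + 2 → ‖(1 - P (j + 1)) (x (j + 1))‖
        ≤ ‖(1 - P j) (x j)‖ + ‖P (j + 1) - P j‖ := by
      intro j hj
      have k1 := app (U (j + 1)) (le_refl ‖(1 - P (j + 1)) (x j)‖)
      have k2 := h.norm_U (j + 1) hj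
      have k3 : (1 - P (j + 1)) (x j) = (1 - P j) (x j) - (P (j + 1) - P j) (x j) := by
        simp only [sub_apply]; abel
      have k4 := app (P (j + 1) - P j) (hx1 j (by omega))
      rw [hx j, cq (j + 1) hj]
      refine k1.trans ((mul_le_of_le_one_left (norm_nonneg _) k2).trans ?_)
      rw [k3]
      refine (norm_sub_le _ _).trans ?_
      linarith
    have d0 := drop 0 (by omega)
    have d1 := drop 1 (by omega)
    have z : (1 - P 0) (x 0) = 0 := by simp [h0]
    simp only [zero_add, Nat.reduceAdd, z, norm_zero] at d0 d1
    linarith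
  have x0 := nXb 0 (by omega) γ₀ hγ₀ hg₀
  have x1 := nXb N le_rfl γ₁ hγ₁ hg₁
  have y0 : ‖y 0‖ ≤ ‖(1 - P 2) (x 2)‖ + ‖X 0‖ := by
    have k := app (X 0) (hx1 2 (by omega))
    have : y 0 = (1 - P 2) (x 2) - X 0 (x 2) := rfl
    rw [this]
    refine (norm_sub_le _ _).trans ?_
    linarith
  have y1 : ‖(1 - P (N + 2)) (x (N + 2))‖ ≤ ‖y N‖ + ‖X N‖ := by
    have k := app (X N) (hx1 (N + 2) le_rfl)
    have : (1 - P (N + 2)) (x (N + 2)) = y N + X N (x (N + 2)) := by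
      simp [hy]
    rw [this]
    refine (norm_add_le _ _).trans ?_
    linarith
  simp only [zero_add] at x0
  have : 0 ≤ (ρ / γ) ^ 2 := by positivity
  linarith

end Dynamics

/-! ### Differences of exponentials by Duhamel's principle -/

section Exponential

variable {B : Type*} [NormedRing B] [NormedAlgebra ℝ B] [CompleteSpace B]

open NormedSpace in
/-- Duhamel's estimate for a linear equation with a contractive propagator. -/
theorem norm_le_of_hasDerivAt_mul_add {A : B} (hA : ∀ t : ℝ, ‖exp (t • A)‖ ≤ 1) {D G : ℝ → B}
    (h0 : D 0 = 0) (hD : ∀ t, HasDerivAt D (A * D t + G t) t) {C : ℝ}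
    (hG : ∀ t ∈ Icc (0 : ℝ) 1, ‖G t‖ ≤ C) {t : ℝ} (ht : t ∈ Icc (0 : ℝ) 1) : ‖D t‖ ≤ C := by
  have hC : 0 ≤ C := (norm_nonneg _).trans (hG t ht)
  let _ : NormedAlgebra ℚ B := NormedAlgebra.restrictScalars ℚ ℝ B
  have hcomm : ∀ s : ℝ, exp ((-s) • A) * exp (s • A) = 1 := fun s => by
    rw [neg_smul, ← exp_add_of_commute (Commute.neg_left (Commute.refl _)), neg_add_cancel,
      exp_zero]
  have hcomm' : ∀ s : ℝ, exp (s • A) * exp ((-s) • A) = 1 := fun s => by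
    simpa using hcomm (-s)
  have hE : ∀ s : ℝ, HasDerivAt (fun s : ℝ => exp ((-s) • A)) (-(exp ((-s) • A) * A)) s := by
    intro s
    have := (hasDerivAt_exp_smul_const (𝕂 := ℝ) A (-s)).scomp s (hasDerivAt_neg s)
    simpa [Function.comp_def] using this
  -- The integrating factor `exp (-s A)` removes the homogeneous term, and contractivity at negative
  -- times makes the mean value inequality lossless.
  have hW : ∀ s : ℝ, HasDerivAt (fun s => exp ((-s) • A) * D s) (exp ((-s) • A) * G s) s := by
    intro s
    refine ((hE s).mul (hD s)).congr_deriv ?_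
    rw [mul_add]
    noncomm_ring
  have hb := norm_image_sub_le_of_norm_deriv_le_segment' (a := (0 : ℝ)) (b := 1) (C := C)
    (fun s _ => (hW s).hasDerivWithinAt) (fun s hs => by
      have := norm_mul_le_of_le' (hA (-s)) (hG s ⟨hs.1, hs.2.le⟩)
      linarith) t ht
  have e : D t = exp (t • A) * (exp ((-t) • A) * D t) := by
    rw [← mul_assoc, hcomm', one_mul]
  have hb' : ‖exp ((-t) • A) * D t‖ ≤ C := by
    have : C * (t - 0) ≤ C := by nlinarith [ht.1, ht.2]
    simpa [h0] using hb.trans this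
  rw [e]
  simpa using norm_mul_le_of_le' (hA t) hb'

open NormedSpace in
-- Differencing `e' = A e` in the index gives for each difference of `exp (t A j)` the same linear
-- equation with zero initial value, forced by differences of `A` times lower differences of the
-- exponentials. The propagators are contractions, so only differences of `A` enter, never its norm.
theorem norm_exp_differences {A : ℕ → B} {M : ℕ} {a₁ a₂ a₃ : ℝ}
    (hA : ∀ j ≤ M, ∀ t : ℝ, ‖exp (t • A j)‖ ≤ 1)
    (h1 : ∀ j, j + 1 ≤ M → ‖fdiff A j‖ ≤ a₁)
    (h2 : ∀ j, j + 2 ≤ M → ‖fdiff (fdiff A) j‖ ≤ a₂)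
    (h3 : ∀ j, j + 3 ≤ M → ‖fdiff (fdiff (fdiff A)) j‖ ≤ a₃) :
    (∀ j, j + 1 ≤ M → ‖fdiff (fun i => exp (A i)) j‖ ≤ ‖fdiff A j‖) ∧
    (∀ j, j + 2 ≤ M → ‖fdiff (fdiff fun i => exp (A i)) j‖ ≤ 2 * (a₁ * a₁) + a₂) ∧
    (∀ j, j + 3 ≤ M → ‖fdiff (fdiff (fdiff fun i => exp (A i))) j‖
      ≤ 3 * (a₁ * (2 * (a₁ * a₁) + a₂)) + 3 * (a₂ * a₁) + a₃) := by
  set e : ℝ → ℕ → B := fun t j => exp (t • A j) with he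
  have e0 : ∀ j, e 0 j = 1 := fun j => by simp [he]
  have e1 : (fun i => exp (A i)) = e 1 := by funext j; simp [he]
  have de : ∀ t j, HasDerivAt (fun t => e t j) (A j * e t j) t := fun t j =>
    hasDerivAt_exp_smul_const' (𝕂 := ℝ) (A j) t
  have one : ∀ t ∈ Icc (0 : ℝ) 1, ∀ j, j + 1 ≤ M → ‖fdiff (e t) j‖ ≤ ‖fdiff A j‖ := by
    intro t ht j hj
    refine norm_le_of_hasDerivAt_mul_add (A := A j) (hA j (by omega)) (D := fun t => fdiff (e t) j)
      (G := fun t => fdiff A j * e t (j + 1)) (by simp [fdiff, e0]) (fun t => ?_) (fun t _ => ?_) ht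
    · refine ((de t (j + 1)).sub (de t j)).congr_deriv ?_
      simp only [fdiff]
      noncomm_ring
    · simpa using norm_mul_le_of_le' (le_refl ‖fdiff A j‖) (hA (j + 1) hj t)
  have one' : ∀ t ∈ Icc (0 : ℝ) 1, ∀ j, j + 1 ≤ M → ‖fdiff (e t) j‖ ≤ a₁ := fun t ht j hj =>
    (one t ht j hj).trans (h1 j hj)
  have two : ∀ t ∈ Icc (0 : ℝ) 1, ∀ j, j + 2 ≤ M → ‖fdiff (fdiff (e t)) j‖
      ≤ 2 * (a₁ * a₁) + a₂ := by
    intro t ht j hj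
    refine norm_le_of_hasDerivAt_mul_add (A := A j) (hA j (by omega))
      (D := fun t => fdiff (fdiff (e t)) j)
      (G := fun t => fdiff A j * fdiff (e t) (j + 1) + fdiff A j * fdiff (e t) (j + 1)
        + fdiff (fdiff A) j * e t (j + 2)) (by simp [fdiff, e0]) (fun t => ?_)
      (fun t ht => ?_) ht
    · refine (((de t (j + 1 + 1)).sub (de t (j + 1))).sub
        ((de t (j + 1)).sub (de t j))).congr_deriv ?_
      simp only [fdiff, mul_sub, sub_mul, add_assoc, Nat.reduceAdd]
      abel
    · have k1 := norm_mul_le_of_le' (h1 j (by omega)) (one' t ht (j + 1) hj)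
      have k2 := norm_mul_le_of_le' (h2 j hj) (hA (j + 2) hj t)
      refine norm_add₃_le.trans ?_
      linarith
  have three : ∀ t ∈ Icc (0 : ℝ) 1, ∀ j, j + 3 ≤ M → ‖fdiff (fdiff (fdiff (e t))) j‖
      ≤ 3 * (a₁ * (2 * (a₁ * a₁) + a₂)) + 3 * (a₂ * a₁) + a₃ := by
    intro t ht j hj
    refine norm_le_of_hasDerivAt_mul_add (A := A j) (hA j (by omega))
      (D := fun t => fdiff (fdiff (fdiff (e t))) j)
      (G := fun t => 3 • (fdiff A j * fdiff (fdiff (e t)) (j + 1))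
        + 3 • (fdiff (fdiff A) j * fdiff (e t) (j + 2))
        + fdiff (fdiff (fdiff A)) j * e t (j + 3)) (by simp [fdiff, e0]) (fun t => ?_)
      (fun t ht => ?_) ht
    · refine ((((de t (j + 1 + 1 + 1)).sub (de t (j + 1 + 1))).sub
        ((de t (j + 1 + 1)).sub (de t (j + 1)))).sub (((de t (j + 1 + 1)).sub (de t (j + 1))).sub
        ((de t (j + 1)).sub (de t j)))).congr_deriv ?_
      simp only [fdiff, mul_sub, sub_mul, add_assoc, Nat.reduceAdd]
      abel
    · have k1 := norm_mul_le_of_le' (h1 j (by omega)) (two t ht (j + 1) hj)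
      have k2 := norm_mul_le_of_le' (h2 j (by omega)) (one' t ht (j + 2) hj)
      have k3 := norm_mul_le_of_le' (h3 j hj) (hA (j + 3) hj t)
      have n3 : ∀ x : B, ‖3 • x‖ ≤ 3 * ‖x‖ := fun x => by
        simpa using norm_nsmul_le (n := 3) (a := x)
      refine norm_add₃_le.trans ((add_le_add (add_le_add (n3 _) (n3 _)) le_rfl).trans ?_)
      linarith
  rw [e1]
  have h01 : (1 : ℝ) ∈ Icc (0 : ℝ) 1 := by simp
  exact ⟨one 1 h01, two 1 h01, three 1 h01⟩

end Exponential

/-! ### Finite differences bounded by derivatives -/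

section Paths

variable {B : Type*} [NormedAddCommGroup B] [NormedSpace ℝ B]

theorem norm_image_sub_le_of_hasDerivWithinAt {F F' : ℝ → B} {S : Set ℝ} (hS : Convex ℝ S) {C : ℝ}
    (h1 : ∀ s ∈ S, HasDerivWithinAt F (F' s) S s) (hb : ∀ s ∈ S, ‖F' s‖ ≤ C)
    {s h : ℝ} (hs : s ∈ S) (hsh : s + h ∈ S) (hh : 0 ≤ h) : ‖F (s + h) - F s‖ ≤ C * h := by
  have := hS.norm_image_sub_le_of_norm_hasDerivWithin_le h1 hb hs hsh
  simpa [abs_of_nonneg hh] using this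

/-- The second difference is the increment of `t ↦ F (t + h) - F t`, whose derivative is a first
difference of `F'`; the mean value inequality applies twice. The third difference is handled the
same way, through the second difference of `F'`. -/
theorem norm_second_difference_le {F F' F'' : ℝ → B} {S : Set ℝ} (hS : Convex ℝ S) {C : ℝ}
    (h1 : ∀ s ∈ S, HasDerivWithinAt F (F' s) S s)
    (h2 : ∀ s ∈ S, HasDerivWithinAt F' (F'' s) S s) (hb : ∀ s ∈ S, ‖F'' s‖ ≤ C)
    {s h : ℝ} (hs : s ∈ S) (hsh : s + 2 * h ∈ S) (hh : 0 ≤ h) :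
    ‖F (s + 2 * h) - F (s + h) - (F (s + h) - F s)‖ ≤ C * h ^ 2 := by
  have hsub : Icc s (s + 2 * h) ⊆ S := hS.ordConnected.out hs hsh
  have hI : Convex ℝ (Icc s (s + h)) := convex_Icc _ _
  have key := norm_image_sub_le_of_hasDerivWithinAt hI (F := fun t => F (t + h) - F t)
    (F' := fun t => F' (t + h) - F' t) (C := C * h) (fun t ht => ?_) (fun t ht => ?_)
    (left_mem_Icc.2 (by linarith)) (right_mem_Icc.2 (by linarith)) hh
  · rw [show s + 2 * h = s + h + h by ring]
    exact key.trans (le_of_eq (by ring))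
  · have a : HasDerivWithinAt (fun t => F (t + h)) (F' (t + h)) (Icc s (s + h)) t := by
      have := (h1 (t + h) (hsub ⟨by linarith [ht.1], by linarith [ht.2]⟩)).scomp_of_eq t
        (((hasDerivAt_id t).add_const h).hasDerivWithinAt (s := Icc s (s + h)))
        (fun u hu => hsub ⟨by simp; linarith [hu.1], by simp; linarith [hu.2]⟩) rfl
      simpa [Function.comp_def] using this
    exact a.sub ((h1 t (hsub ⟨ht.1, by linarith [ht.2]⟩)).mono
      ((Icc_subset_Icc_right (by linarith)).trans hsub))
  · exact norm_image_sub_le_of_hasDerivWithinAt hS h2 hb (hsub ⟨ht.1, by linarith [ht.2]⟩)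
      (hsub ⟨by linarith [ht.1], by linarith [ht.2]⟩) hh

theorem norm_third_difference_le {F F' F'' F''' : ℝ → B} {S : Set ℝ} (hS : Convex ℝ S) {C : ℝ}
    (h1 : ∀ s ∈ S, HasDerivWithinAt F (F' s) S s)
    (h2 : ∀ s ∈ S, HasDerivWithinAt F' (F'' s) S s)
    (h3 : ∀ s ∈ S, HasDerivWithinAt F'' (F''' s) S s) (hb : ∀ s ∈ S, ‖F''' s‖ ≤ C)
    {s h : ℝ} (hs : s ∈ S) (hsh : s + 3 * h ∈ S) (hh : 0 ≤ h) :
    ‖F (s + 3 * h) - F (s + 2 * h) - (F (s + 2 * h) - F (s + h))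
      - (F (s + 2 * h) - F (s + h) - (F (s + h) - F s))‖ ≤ C * h ^ 3 := by
  have hsub : Icc s (s + 3 * h) ⊆ S := hS.ordConnected.out hs hsh
  have hI : Convex ℝ (Icc s (s + h)) := convex_Icc _ _
  have shift : ∀ c, 0 ≤ c → c ≤ 2 * h → ∀ t ∈ Icc s (s + h),
      HasDerivWithinAt (fun t => F (t + c)) (F' (t + c)) (Icc s (s + h)) t := by
    intro c hc hc2 t ht
    have := (h1 (t + c) (hsub ⟨by linarith [ht.1], by linarith [ht.2]⟩)).scomp_of_eq t
      (((hasDerivAt_id t).add_const c).hasDerivWithinAt (s := Icc s (s + h)))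
      (fun u hu => hsub ⟨by simp; linarith [hu.1], by simp; linarith [hu.2]⟩) rfl
    simpa [Function.comp_def] using this
  have key := norm_image_sub_le_of_hasDerivWithinAt hI
    (F := fun t => F (t + 2 * h) - F (t + h) - (F (t + h) - F (t + 0)))
    (F' := fun t => F' (t + 2 * h) - F' (t + h) - (F' (t + h) - F' (t + 0))) (C := C * h ^ 2)
    (fun t ht => ?_) (fun t ht => ?_)
    (left_mem_Icc.2 (by linarith)) (right_mem_Icc.2 (by linarith)) hh
  · rw [show s + 3 * h = s + h + 2 * h by ring]
    have e1 : s + h + h = s + 2 * h := by ring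
    simp only [e1, add_zero] at key
    exact key.trans (le_of_eq (by ring))
  · exact ((shift (2 * h) (by linarith) le_rfl t ht).sub (shift h hh (by linarith) t ht)).sub
      ((shift h hh (by linarith) t ht).sub (shift 0 le_rfl (by linarith) t ht))
  · rw [add_zero]
    exact norm_second_difference_le hS h2 h3 hb (hsub ⟨ht.1, by linarith [ht.2]⟩)
      (hsub ⟨by linarith [ht.1], by linarith [ht.2]⟩) hh

end Paths

/-! ### Spectral gap and perturbation of projections from the reduced resolvent -/

section ReducedResolvent

variable {B : Type*} [NormedRing B] [NormedAlgebra ℂ B]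

/-- `P` is a spectral projection of `U` for the eigenvalue `u`, and `S` the reduced resolvent. -/
structure IsReducedResolvent (U P S : B) (u : ℂ) : Prop where
  left_inv : S * (U - u • 1) = 1 - P
  right_inv : (U - u • 1) * S = 1 - P
  U_mul_P : U * P = u • P
  P_mul_U : P * U = u • P
  idem : P * P = P
  P_mul_S : P * S = 0
  S_mul_P : S * P = 0

variable {U P S U' P' S' : B} {u u' : ℂ} {γ γ' a : ℝ}

/-- On the blocks that are off-diagonal for `P`, one factor `U` acts as the scalar `u`, so the
commutator is multiplication by `U - u` on one side up to sign. The reduced resolvent `S` inverts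
it. -/
theorem IsReducedResolvent.spectralGap (h : IsReducedResolvent U P S u) (hγ : 0 < γ)
    (hS : ‖S‖ ≤ 1 / γ) (hP : ‖P‖ ≤ 1) (hQ : ‖1 - P‖ ≤ 1) : SpectralGap U P γ where
  norm_lower_le X := by
    have e : (1 - P) * X * P = S * ((1 - P) * (U * X - X * U) * P) := by
      have e1 : (1 - P) * (U * X - X * U) * P = (U - u • 1) * ((1 - P) * X * P) := by
        have a1 : ∀ t, P * (U * t) = u • (P * t) := fun t => by
          rw [← mul_assoc, h.P_mul_U, smul_mul_assoc]
        have a2 : ∀ t, U * (P * t) = u • (P * t) := fun t => by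
          rw [← mul_assoc, h.U_mul_P, smul_mul_assoc]
        simp only [mul_sub, sub_mul, mul_assoc, h.U_mul_P, mul_smul_comm, smul_mul_assoc, one_mul,
          a1, a2]
        abel
      rw [e1, ← mul_assoc, h.left_inv, ← mul_assoc, ← mul_assoc]
      simp only [mul_sub, sub_mul, one_mul, mul_one, h.idem, sub_self, sub_zero]
    rw [e]
    have := norm_mul_le_of_le' hS (norm_mul_le_of_le' (norm_mul_le_of_le' hQ
      (le_refl ‖U * X - X * U‖)) hP)
    rw [mul_comm, ← le_div_iff₀ hγ]
    refine this.trans (le_of_eq ?_)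
    field_simp
  norm_upper_le X := by
    have e : P * X * (1 - P) = -(P * (U * X - X * U) * (1 - P) * S) := by
      have e1 : P * (U * X - X * U) * (1 - P) = -(P * X * (1 - P) * (U - u • 1)) := by
        have a1 : ∀ t, P * (U * t) = u • (P * t) := fun t => by
          rw [← mul_assoc, h.P_mul_U, smul_mul_assoc]
        simp only [mul_sub, sub_mul, mul_assoc, h.U_mul_P, h.P_mul_U, mul_smul_comm,
          smul_mul_assoc, mul_one, a1, smul_sub]
        abel
      rw [e1, neg_mul, neg_neg, mul_assoc _ (U - u • 1), h.right_inv]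
      simp only [mul_assoc]
      simp only [mul_sub, sub_mul, one_mul, mul_one, h.idem, sub_self, sub_zero]
    rw [e, norm_neg]
    have := norm_mul_le_of_le' (norm_mul_le_of_le' (norm_mul_le_of_le' hP
      (le_refl ‖U * X - X * U‖)) hQ) hS
    rw [mul_comm, ← le_div_iff₀ hγ]
    refine this.trans (le_of_eq ?_)
    field_simp
  exists_solution F := by
    refine ⟨S * F * P, ?_, ?_, ?_⟩
    · rw [← mul_assoc, ← mul_assoc, h.P_mul_S, zero_mul, zero_mul]
    · rw [mul_assoc, h.idem]
    · rw [mul_assoc (S * F), h.P_mul_U, ← h.right_inv]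
      simp only [sub_mul, mul_smul_comm, smul_mul_assoc, one_mul, mul_assoc]

/-- Perturbation of spectral projections. -/
theorem IsReducedResolvent.norm_sub_le (h : IsReducedResolvent U P S u)
    (h' : IsReducedResolvent U' P' S' u') (hγ : 0 < γ) (hγ' : 0 < γ') (hS : ‖S‖ ≤ 1 / γ)
    (hS' : ‖S'‖ ≤ 1 / γ') (hP : ‖P‖ ≤ 1) (hP' : ‖P'‖ ≤ 1) (hU : ‖U' - U‖ ≤ a)
    (hu : ‖u' - u‖ ≤ a) : ‖P' - P‖ ≤ 2 * a / γ + 2 * a / γ' := by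
  -- Write `1 - P'` as `S' (U' - u')`. Since `U P = u P`, only `U' - U` and `u' - u` survive next to
  -- `P`.
  have e1 : (1 - P') * P = S' * ((U' - U) * P - (u' - u) • P) := by
    rw [← h'.left_inv, mul_assoc]
    congr 1
    simp only [sub_mul, h.U_mul_P, sub_smul, smul_mul_assoc, one_mul]
    abel
  have e2 : P' * (1 - P) = (-(P' * (U' - U)) + (u' - u) • P') * S := by
    rw [← h.right_inv, ← mul_assoc]
    congr 1
    simp only [mul_sub, h'.P_mul_U, sub_smul, mul_smul_comm, mul_one]
    abel
  have e : P' - P = P' * (1 - P) - (1 - P') * P := by noncomm_ring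
  have s1 : ‖(u' - u) • P‖ ≤ a := by
    rw [norm_smul]
    have := mul_le_mul hu hP (norm_nonneg _) ((norm_nonneg _).trans hu)
    linarith
  have s2 : ‖(u' - u) • P'‖ ≤ a := by
    rw [norm_smul]
    have := mul_le_mul hu hP' (norm_nonneg _) ((norm_nonneg _).trans hu)
    linarith
  have k1 := norm_mul_le_of_le' hS' (norm_sub_le_of_le (norm_mul_le_of_le' hU hP) s1)
  have k2 : ‖(-(P' * (U' - U)) + (u' - u) • P') * S‖ ≤ (1 * a + a) * (1 / γ) := by
    refine norm_mul_le_of_le' (norm_add_le_of_le ?_ s2) hS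
    rw [norm_neg]
    exact norm_mul_le_of_le' hP' hU
  rw [e, e1, e2]
  refine (norm_sub_le_of_le k2 k1).trans (le_of_eq ?_)
  field_simp
  ring

end ReducedResolvent

/-! ### Operators diagonal in an orthonormal eigenbasis -/

section Diagonal

variable {N : ℕ} (b : OrthonormalBasis (Fin N) ℂ (State N))

/-- The operator that is diagonal in the orthonormal basis `b`, with entries `f`. -/
noncomputable def diagOp : (Fin N → ℂ) →ₐ[ℂ] Op N :=
  AlgHom.ofLinearMap
    { toFun := fun f => ∑ l, f l • (innerSL ℂ (b l)).smulRight (b l)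
      map_add' := fun f g => by simp [add_smul, Finset.sum_add_distrib]
      map_smul' := fun c f => by simp [mul_smul, Finset.smul_sum] }
    (by
      ext1 v
      simp [b.sum_repr'])
    (fun f g => by
      ext1 v
      simp only [LinearMap.coe_mk, AddHom.coe_mk, mul_apply_eq_comp, sum_apply,
        smul_apply, ContinuousLinearMap.smulRight_apply, innerSL_apply_apply,
        Pi.mul_apply, inner_sum, inner_smul_right, orthonormal_iff_ite.1 b.orthonormal, smul_smul]
      simp [mul_assoc])

theorem diagOp_apply (f : Fin N → ℂ) (v : State N) :
    diagOp b f v = ∑ l, (f l * inner ℂ (b l) v) • b l := by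
  change (∑ l, f l • (innerSL ℂ (b l)).smulRight (b l) : Op N) v = _
  simp [mul_smul]

theorem inner_diagOp_apply (f : Fin N → ℂ) (v : State N) (l : Fin N) :
    inner ℂ (b l) (diagOp b f v) = f l * inner ℂ (b l) v := by
  rw [diagOp_apply]
  simp [orthonormal_iff_ite.1 b.orthonormal]

theorem diagOp_apply_basis (f : Fin N → ℂ) (l : Fin N) : diagOp b f (b l) = f l • b l := by
  rw [diagOp_apply]
  simp [orthonormal_iff_ite.1 b.orthonormal]

theorem norm_sq_eq_sum_inner (v : State N) : ‖v‖ ^ 2 = ∑ l, ‖inner ℂ (b l) v‖ ^ 2 :=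
  (b.sum_sq_norm_inner_right v).symm

theorem norm_diagOp_le {f : Fin N → ℂ} {c : ℝ} (hc : 0 ≤ c) (h : ∀ l, ‖f l‖ ≤ c) :
    ‖diagOp b f‖ ≤ c := by
  refine ContinuousLinearMap.opNorm_le_bound _ hc fun v => ?_
  refine le_of_sq_le_sq ?_ (by positivity)
  rw [mul_pow, norm_sq_eq_sum_inner b v, norm_sq_eq_sum_inner b, Finset.mul_sum]
  refine Finset.sum_le_sum fun l _ => ?_
  rw [inner_diagOp_apply, norm_mul, mul_pow]
  gcongr
  exact h l

theorem exp_diagOp (f : Fin N → ℂ) :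
    NormedSpace.exp (diagOp b f) = diagOp b fun l => Complex.exp (f l) := by
  have hc : Continuous (diagOp b) := (diagOp b).toLinearMap.continuous_of_finiteDimensional
  rw [← NormedSpace.map_exp (diagOp b) hc, Complex.exp_eq_exp_ℂ]
  congr 1
  funext l
  rw [Pi.coe_exp]

theorem re_inner_diagOp (f : Fin N → ℝ) (v : State N) :
    (inner ℂ v (diagOp b (fun l => (f l : ℂ)) v)).re = ∑ l, f l * ‖inner ℂ (b l) v‖ ^ 2 := by
  rw [diagOp_apply, inner_sum, Complex.re_sum]
  refine Finset.sum_congr rfl fun l _ => ?_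
  rw [inner_smul_right, mul_assoc, ← inner_conj_symm v (b l), Complex.mul_conj']
  norm_cast

variable {A : Op N} {E : Fin N → ℝ}

/-- Unit eigenvectors of a self-adjoint operator for distinct eigenvalues are orthonormal, and `N`
of them span. As `diagOp b` is an algebra homomorphism, later identities between functions of `A`
reduce to identities between entries. -/
theorem IsEnergyLevels.exists_basis (hA : IsSelfAdjoint A) (hE : IsEnergyLevels A E) :
    ∃ b : OrthonormalBasis (Fin N) ℂ (State N), A = diagOp b fun l => (E l : ℂ) := by
  have hex : ∀ l, ∃ v : State N, ‖v‖ = 1 ∧ A v = (E l : ℂ) • v := by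
    intro l
    obtain ⟨v, hv⟩ := (hE.2 l).exists_hasEigenvector
    have hv0 : ‖v‖ ≠ 0 := norm_ne_zero_iff.2 hv.2
    refine ⟨((‖v‖⁻¹ : ℝ) : ℂ) • v, by simp [norm_smul, hv0], ?_⟩
    have : A v = (E l : ℂ) • v := hv.apply_eq_smul
    rw [map_smul, this, smul_comm]
  choose v hv1 hv2 using hex
  have hsym : (A : State N →ₗ[ℂ] State N).IsSymmetric :=
    ContinuousLinearMap.isSelfAdjoint_iff_isSymmetric.1 hA
  have hon : Orthonormal ℂ v := by
    refine ⟨hv1, fun i j hij => ?_⟩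
    have h1 : inner ℂ (A (v i)) (v j) = inner ℂ (v i) (A (v j)) := hsym (v i) (v j)
    rw [hv2, hv2, inner_smul_left, inner_smul_right, Complex.conj_ofReal] at h1
    have h2 : ((E i : ℂ) - E j) * inner ℂ (v i) (v j) = 0 := by rw [sub_mul, h1, sub_self]
    rcases mul_eq_zero.1 h2 with h3 | h3
    · exact absurd (hE.1.injective (by exact_mod_cast sub_eq_zero.1 h3)) hij
    · exact h3
  let b := OrthonormalBasis.mk hon
    (hon.linearIndependent.span_eq_top_of_card_eq_finrank' (by simp)).ge
  have hb : ∀ l, b l = v l := fun l => by simp [b]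
  refine ⟨b, ?_⟩
  have : (A : State N →ₗ[ℂ] State N) = (diagOp b fun l => (E l : ℂ) : Op N) := by
    refine b.toBasis.ext fun l => ?_
    simp only [b.coe_toBasis]
    change A (b l) = diagOp b (fun l => (E l : ℂ)) (b l)
    rw [diagOp_apply_basis, hb, hv2]
  exact ContinuousLinearMap.coe_injective this

end Diagonal

/-! ### Separation of the phases of one step -/

section Phases

/-- Concavity gives `sin y ≥ (2/π) y` up to `π/2`, and by reflection `sin y ≥ (2/π)(π - y)` beyond
it. The bound `1.89` is half of `3.78`; at this end `0.62 (3.14 - 1.89) = 0.775` still exceeds `0.4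
· 1.89 = 0.756`. -/
theorem le_sin_of_le {y : ℝ} (h0 : 0 ≤ y) (h1 : y ≤ 1.89) : 0.4 * y ≤ Real.sin y := by
  have hp := Real.pi_gt_d2
  have hp' := Real.pi_lt_d2
  rcases le_total y (Real.pi / 2) with h | h
  · refine le_trans ?_ (Real.mul_le_sin h0 h)
    have : (0.4 : ℝ) ≤ 2 / Real.pi := by rw [le_div_iff₀ Real.pi_pos]; linarith
    gcongr
  · have k := Real.mul_le_sin (x := Real.pi - y) (by linarith) (by linarith)
    rw [Real.sin_pi_sub] at k
    have : (0.62 : ℝ) ≤ 2 / Real.pi := by rw [le_div_iff₀ Real.pi_pos]; linarith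
    have : 0.62 * (Real.pi - y) ≤ 2 / Real.pi * (Real.pi - y) := by
      gcongr
      linarith
    linarith

theorem norm_exp_sub_exp (a c δ : ℝ) :
    ‖Complex.exp (-(Complex.I * δ) * a) - Complex.exp (-(Complex.I * δ) * c)‖
      = ‖Complex.exp (Complex.I * (((c - a) * δ : ℝ) : ℂ)) - 1‖ := by
  have e : Complex.exp (-(Complex.I * δ) * a) - Complex.exp (-(Complex.I * δ) * c)
      = Complex.exp (Complex.I * ((-(δ * c) : ℝ) : ℂ))
        * (Complex.exp (Complex.I * (((c - a) * δ : ℝ) : ℂ)) - 1) := by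
    rw [mul_sub, ← Complex.exp_add, mul_one]
    push_cast
    ring_nf
  rw [e, norm_mul, Complex.norm_exp_I_mul_ofReal, one_mul]

theorem norm_exp_sub_exp_le (a c : ℝ) {δ : ℝ} (hδ : 0 ≤ δ) :
    ‖Complex.exp (-(Complex.I * δ) * a) - Complex.exp (-(Complex.I * δ) * c)‖ ≤ δ * |a - c| := by
  rw [norm_exp_sub_exp]
  refine Real.norm_exp_I_mul_ofReal_sub_one_le.trans (le_of_eq ?_)
  rw [Real.norm_eq_abs, abs_mul, abs_of_nonneg hδ, abs_sub_comm, mul_comm]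

theorem le_norm_exp_sub_exp {a c δ : ℝ} (h0 : 0 ≤ (a - c) * δ) (h1 : (a - c) * δ < 3.78) :
    0.4 * ((a - c) * δ)
      ≤ ‖Complex.exp (-(Complex.I * δ) * a) - Complex.exp (-(Complex.I * δ) * c)‖ := by
  rw [← norm_neg, neg_sub, norm_exp_sub_exp, Complex.norm_exp_I_mul_ofReal_sub_one]
  refine le_trans ?_ (Real.le_norm_self _)
  have := le_sin_of_le (y := (a - c) * δ / 2) (by linarith) (by linarith)
  linarith

theorem norm_exp_phase (a δ : ℝ) : ‖Complex.exp (-(Complex.I * δ) * a)‖ = 1 := by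
  rw [show -(Complex.I * δ) * (a : ℂ) = Complex.I * ((-(δ * a) : ℝ) : ℂ) by push_cast; ring,
    Complex.norm_exp_I_mul_ofReal]

end Phases

/-! ### Ground projection of a step, and stability of the two lowest levels -/

section EnergyLevels

variable {d : ℕ} {A A' : Op (d + 2)} {E E' : Fin (d + 2) → ℝ}

theorem gap_pos (hE : StrictMono E) : 0 < gap E := sub_pos.2 (hE (by simp))

theorem gap_le (hE : StrictMono E) {l : Fin (d + 2)} (hl : l ≠ 0) : gap E ≤ E l - E 0 := by
  have : (1 : Fin (d + 2)) ≤ l := Fin.one_le_of_ne_zero hl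
  have := hE.monotone this
  rw [gap]
  linarith

theorem exp_smul_eq_diagOp {N : ℕ} (b : OrthonormalBasis (Fin N) ℂ (State N)) (E : Fin N → ℝ)
    (z : ℂ) : NormedSpace.exp (z • diagOp b fun l => (E l : ℂ))
      = diagOp b fun l => Complex.exp (z * E l) := by
  rw [← map_smul, exp_diagOp]
  rfl

theorem norm_exp_step_le {N : ℕ} {A : Op N} {E : Fin N → ℝ} (hA : IsSelfAdjoint A)
    (hE : IsEnergyLevels A E) (δ : ℝ) :
    ‖NormedSpace.exp ((-(Complex.I * (δ : ℂ))) • A)‖ ≤ 1 := by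
  obtain ⟨b, rfl⟩ := hE.exists_basis hA
  rw [exp_smul_eq_diagOp]
  exact norm_diagOp_le b zero_le_one fun l => (norm_exp_phase _ _).le

theorem norm_exp_step_apply {N : ℕ} {A : Op N} {E : Fin N → ℝ} (hA : IsSelfAdjoint A)
    (hE : IsEnergyLevels A E) (δ : ℝ) (v : State N) :
    ‖NormedSpace.exp ((-(Complex.I * (δ : ℂ))) • A) v‖ = ‖v‖ := by
  obtain ⟨b, rfl⟩ := hE.exists_basis hA
  rw [exp_smul_eq_diagOp]
  refine (sq_eq_sq₀ (norm_nonneg _) (norm_nonneg _)).1 ?_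
  rw [norm_sq_eq_sum_inner b, norm_sq_eq_sum_inner b]
  refine Finset.sum_congr rfl fun l _ => ?_
  rw [inner_diagOp_apply, norm_mul, norm_exp_phase, one_mul]

/-- The ground state projection and the reduced resolvent of one step of the evolution. -/
theorem exists_ground_projection (hA : IsSelfAdjoint A) (hE : IsEnergyLevels A E) {δ : ℝ}
    (hδ : 0 < δ) (hstep : ∀ l, (E l - E 0) * δ < 3.78) :
    ∃ P S : Op (d + 2), IsReducedResolvent (NormedSpace.exp ((-(Complex.I * (δ : ℂ))) • A)) P S
        (Complex.exp (-(Complex.I * δ) * E 0)) ∧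
      ‖S‖ ≤ 1 / (0.4 * (gap E * δ)) ∧ ‖P‖ ≤ 1 ∧ ‖1 - P‖ ≤ 1 ∧
      (∀ ψ, IsEigenstate A (E 0) ψ → P ψ = ψ) ∧
      (∀ ψ x, IsEigenstate A (E 0) ψ → ‖x‖ = 1 → 1 - ‖inner ℂ ψ x‖ ^ 2 = ‖(1 - P) x‖ ^ 2) := by
  obtain ⟨b, rfl⟩ := hE.exists_basis hA
  have hgap := gap_pos hE.1
  set z : Fin (d + 2) → ℂ := fun l => Complex.exp (-(Complex.I * δ) * E l) with hz
  set p : Fin (d + 2) → ℂ := Pi.single 0 1 with hp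
  set r : Fin (d + 2) → ℂ := fun l => if l = 0 then 0 else (z l - z 0)⁻¹ with hr
  have hlow : ∀ l, l ≠ 0 → 0.4 * (gap E * δ) ≤ ‖z l - z 0‖ := by
    intro l hl
    have h1 := gap_le hE.1 hl
    have h2 : gap E * δ ≤ (E l - E 0) * δ := by gcongr
    have h3 : 0 < gap E * δ := by positivity
    have := le_norm_exp_sub_exp (a := E l) (c := E 0) (δ := δ) (by linarith) (hstep l)
    simp only [hz]
    linarith
  have hpos : 0 < 0.4 * (gap E * δ) := by positivity
  have hne : ∀ l, l ≠ 0 → z l - z 0 ≠ 0 := fun l hl =>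
    norm_pos_iff.1 (hpos.trans_le (hlow l hl))
  have hU : NormedSpace.exp ((-(Complex.I * (δ : ℂ))) • diagOp b fun l => (E l : ℂ))
      = diagOp b z := exp_smul_eq_diagOp b E _
  have hone : (1 : Op (d + 2)) = diagOp b 1 := (map_one _).symm
  have hcoef : ∀ ψ, IsEigenstate (diagOp b fun l => (E l : ℂ)) (E 0) ψ →
      ∀ l, l ≠ 0 → inner ℂ (b l) ψ = 0 := by
    intro ψ hψ l hl
    have h1 := congrArg (inner ℂ (b l)) hψ.2
    rw [inner_diagOp_apply, inner_smul_right, ← sub_eq_zero, ← sub_mul] at h1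
    refine (mul_eq_zero.1 h1).resolve_left fun h2 => hl (hE.1.injective ?_)
    exact_mod_cast sub_eq_zero.1 h2
  have hψb : ∀ ψ, IsEigenstate (diagOp b fun l => (E l : ℂ)) (E 0) ψ →
      ψ = inner ℂ (b 0) ψ • b 0 := by
    intro ψ hψ
    conv_lhs => rw [← b.sum_repr' ψ]
    refine Finset.sum_eq_single 0 (fun l _ hl => ?_) (by simp)
    rw [hcoef ψ hψ l hl, zero_smul]
  have hQ : (1 : Op (d + 2)) - diagOp b p = diagOp b (1 - p) := by rw [hone, map_sub]
  rw [hU]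
  refine ⟨diagOp b p, diagOp b r, ⟨?_, ?_, ?_, ?_, ?_, ?_, ?_⟩, ?_, ?_, ?_, fun ψ hψ => ?_,
    fun ψ x hψ hx => ?_⟩
  · rw [hone, ← map_smul, ← map_sub, ← map_mul, ← map_sub]
    congr 1
    funext l
    by_cases hl : l = 0
    · subst hl; simp [hr, hp]
    · simpa [hr, hp, hl, hz] using inv_mul_cancel₀ (hne l hl)
  · rw [hone, ← map_smul, ← map_sub, ← map_mul, ← map_sub]
    congr 1
    funext l
    by_cases hl : l = 0
    · subst hl; simp [hr, hp]
    · simpa [hr, hp, hl, hz] using mul_inv_cancel₀ (hne l hl)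
  · rw [← map_smul, ← map_mul]
    congr 1
    funext l
    by_cases hl : l = 0
    · subst hl; simp [hp, hz]
    · simp [hp, hl]
  · rw [← map_smul, ← map_mul]
    congr 1
    funext l
    by_cases hl : l = 0
    · subst hl; simp [hp, hz]
    · simp [hp, hl]
  · rw [← map_mul]
    congr 1
    funext l
    by_cases hl : l = 0
    · subst hl; simp [hp]
    · simp [hp, hl]
  · rw [← map_mul, ← map_zero (diagOp b)]
    congr 1
    funext l
    by_cases hl : l = 0
    · subst hl; simp [hr]
    · simp [hp, hl]
  · rw [← map_mul, ← map_zero (diagOp b)]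
    congr 1
    funext l
    by_cases hl : l = 0
    · subst hl; simp [hr]
    · simp [hp, hl]
  · refine norm_diagOp_le b (by positivity) fun l => ?_
    by_cases hl : l = 0
    · simp only [hr, hl, if_true, norm_zero]
      positivity
    · simp only [hr, hl, if_false, norm_inv, one_div]
      exact inv_anti₀ hpos (hlow l hl)
  · refine norm_diagOp_le b zero_le_one fun l => ?_
    by_cases hl : l = 0
    · subst hl; simp [hp]
    · simp [hp, hl]
  · rw [hQ]
    refine norm_diagOp_le b zero_le_one fun l => ?_
    by_cases hl : l = 0
    · subst hl; simp [hp]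
    · simp [hp, hl]
  · rw [hψb ψ hψ, map_smul, diagOp_apply_basis]
    simp [hp]
  · have hc : ‖inner ℂ (b 0) ψ‖ = 1 := by
      have := hψ.1
      rw [hψb ψ hψ, norm_smul, b.norm_eq_one, mul_one] at this
      exact this
    have hin : ‖inner ℂ ψ x‖ = ‖inner ℂ (b 0) x‖ := by
      conv_lhs => rw [hψb ψ hψ, inner_smul_left, norm_mul, RCLike.norm_conj, hc, one_mul]
    rw [hin, hQ, norm_sq_eq_sum_inner b ((diagOp b (1 - p)) x), Fin.sum_univ_succ]
    have hx2 : ‖x‖ ^ 2 = 1 := by rw [hx]; norm_num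
    rw [norm_sq_eq_sum_inner b, Fin.sum_univ_succ] at hx2
    simp only [inner_diagOp_apply]
    simp [hp, ← hx2]

/-- Weyl's inequalities for the two lowest levels, in one direction. -/
theorem energy_le_add (hA : IsSelfAdjoint A) (hE : IsEnergyLevels A E) (hA' : IsSelfAdjoint A')
    (hE' : IsEnergyLevels A' E') {r : ℝ} (hr : ‖A' - A‖ ≤ r) :
    E' 0 ≤ E 0 + r ∧ E' 1 ≤ E 1 + r := by
  obtain ⟨b, hb⟩ := hE.exists_basis hA
  obtain ⟨b', hb'⟩ := hE'.exists_basis hA'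
  have pert : ∀ v : State (d + 2), (inner ℂ v (A' v)).re ≤ (inner ℂ v (A v)).re + r * ‖v‖ ^ 2 := by
    intro v
    have h1 : (inner ℂ v (A' v)).re = (inner ℂ v (A v)).re + (inner ℂ v ((A' - A) v)).re := by
      rw [sub_apply, inner_sub_right, Complex.sub_re]; ring
    have h2 : (inner ℂ v ((A' - A) v)).re ≤ ‖v‖ * ‖(A' - A) v‖ :=
      (Complex.re_le_norm _).trans (norm_inner_le_norm _ _)
    have h3 : ‖(A' - A) v‖ ≤ r * ‖v‖ := (ContinuousLinearMap.le_opNorm _ _).trans (by gcongr)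
    have h4 : ‖v‖ * ‖(A' - A) v‖ ≤ ‖v‖ * (r * ‖v‖) := by gcongr
    nlinarith
  -- Courant–Fischer argument: a test vector spanned by levels of `A` up to `k` and orthogonal to
  -- the levels of `A'` below `k` compares the two quadratic forms.
  have main : ∀ (k : Fin (d + 2)) (v : State (d + 2)), v ≠ 0 →
      (∀ l, E k < E l → inner ℂ (b l) v = 0) → (∀ l, E' l < E' k → inner ℂ (b' l) v = 0) →
      E' k ≤ E k + r := by
    intro k v hv hup hlow
    have h1 : (inner ℂ v (A v)).re ≤ E k * ‖v‖ ^ 2 := by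
      rw [hb, re_inner_diagOp, norm_sq_eq_sum_inner b, Finset.mul_sum]
      refine Finset.sum_le_sum fun l _ => ?_
      rcases lt_or_ge (E k) (E l) with h | h
      · simp [hup l h]
      · gcongr
    have h2 : E' k * ‖v‖ ^ 2 ≤ (inner ℂ v (A' v)).re := by
      rw [hb', re_inner_diagOp, norm_sq_eq_sum_inner b', Finset.mul_sum]
      refine Finset.sum_le_sum fun l _ => ?_
      rcases lt_or_ge (E' l) (E' k) with h | h
      · simp [hlow l h]
      · gcongr
    have h3 := pert v
    have hv2 : 0 < ‖v‖ ^ 2 := by positivity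
    refine le_of_mul_le_mul_right (a := ‖v‖ ^ 2) ?_ hv2
    linarith
  have ort := orthonormal_iff_ite.1 b.orthonormal
  have lt_one : ∀ l : Fin (d + 2), l < 1 → l = 0 := fun l hl => by
    exact Fin.lt_one_iff l |>.1 hl
  constructor
  · refine main 0 (b 0) (b.orthonormal.ne_zero 0) (fun l hl => ?_) fun l hl => ?_
    · rw [ort, if_neg]
      rintro rfl
      exact lt_irrefl _ hl
    · exact absurd (hE'.1.lt_iff_lt.1 hl) (by simp)
  -- For the second level the test vector is a combination of `b 0` and `b 1` orthogonal to `b' 0`.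
  -- The explicit combination is nonzero unless `b 0` itself is orthogonal to `b' 0`, in which case
  -- `b 0` serves.
  · by_cases h0 : inner ℂ (b' 0) (b 0) = 0
    · refine main 1 (b 0) (b.orthonormal.ne_zero 0) (fun l hl => ?_) fun l hl => ?_
      · rw [ort, if_neg]
        rintro rfl
        exact absurd (hE.1.lt_iff_lt.1 hl) (by simp)
      · rw [lt_one l (hE'.1.lt_iff_lt.1 hl), h0]
    · refine main 1 (inner ℂ (b' 0) (b 1) • b 0 - inner ℂ (b' 0) (b 0) • b 1) (fun h => h0 ?_)
        (fun l hl => ?_) fun l hl => ?_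
      · have := congrArg (inner ℂ (b 1)) h
        simpa [inner_sub_right, inner_smul_right, ort] using this
      · have hl1 := hE.1.lt_iff_lt.1 hl
        have l0 : l ≠ 0 := by rintro rfl; exact absurd hl1 (by simp)
        rw [inner_sub_right, inner_smul_right, inner_smul_right, ort, ort, if_neg l0,
          if_neg hl1.ne', mul_zero, mul_zero, sub_zero]
      · rw [lt_one l (hE'.1.lt_iff_lt.1 hl), inner_sub_right, inner_smul_right, inner_smul_right]
        ring

theorem abs_ground_energy_sub_le (hA : IsSelfAdjoint A) (hE : IsEnergyLevels A E)
    (hA' : IsSelfAdjoint A') (hE' : IsEnergyLevels A' E') {r : ℝ} (hr : ‖A' - A‖ ≤ r) :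
    |E' 0 - E 0| ≤ r := by
  have h1 := (energy_le_add hA hE hA' hE' hr).1
  have h2 := (energy_le_add hA' hE' hA hE (r := r) (by rwa [norm_sub_rev])).1
  exact abs_sub_le_iff.2 ⟨by linarith, by linarith⟩

theorem gap_le_gap_add (hA : IsSelfAdjoint A) (hE : IsEnergyLevels A E)
    (hA' : IsSelfAdjoint A') (hE' : IsEnergyLevels A' E') {r : ℝ} (hr : ‖A' - A‖ ≤ r) :
    gap E' ≤ gap E + 2 * r := by
  have h1 := (energy_le_add hA hE hA' hE' hr).2
  have h2 := (energy_le_add hA' hE' hA hE (r := r) (by rwa [norm_sub_rev])).1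
  rw [gap, gap]
  linarith

end EnergyLevels

/-! ### The sampled Hamiltonian path -/

section Path

variable {N : ℕ} {H : ℝ → Op N}

theorem pathDeriv_zero (H : ℝ → Op N) : pathDeriv 0 H = H := by
  funext s
  simp [pathDeriv]

theorem hasDerivWithinAt_pathDeriv (hH : ContDiffOn ℝ 3 H (Icc 0 1)) {k : ℕ} (hk : k < 3) {s : ℝ}
    (hs : s ∈ Icc (0 : ℝ) 1) :
    HasDerivWithinAt (pathDeriv k H) (pathDeriv (k + 1) H s) (Icc 0 1) s := by
  have hd := hH.differentiableOn_iteratedDerivWithin (m := k) (by exact_mod_cast hk)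
    (uniqueDiffOn_Icc zero_lt_one)
  have := (hd s hs).hasDerivWithinAt
  rwa [← iteratedDerivWithin_succ] at this

theorem norm_fdiff_path_le (hH : ContDiffOn ℝ 3 H (Icc 0 1)) {L : ℕ} (hL : 0 < L) {S : Set ℝ}
    (hS : Convex ℝ S) (hS1 : S ⊆ Icc 0 1) {c : ℝ} (hc : ∀ s ∈ S, ‖pathDeriv 1 H s‖ ≤ c) {j : ℕ}
    (h0 : (j : ℝ) / L ∈ S) (h1 : ((j + 1 : ℕ) : ℝ) / L ∈ S) :
    ‖fdiff (fun j : ℕ => H ((j : ℝ) / L)) j‖ ≤ c * (1 / L) := by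
  have hL' : (0 : ℝ) < L := by exact_mod_cast hL
  have e1 : ((j + 1 : ℕ) : ℝ) / L = (j : ℝ) / L + 1 / L := by push_cast; ring
  rw [e1] at h1
  have := norm_image_sub_le_of_hasDerivWithinAt hS (F := H)
    (fun s hs => by
      have := hasDerivWithinAt_pathDeriv hH (k := 0) (by norm_num) (hS1 hs)
      rw [pathDeriv_zero] at this
      exact this.mono hS1) hc h0 h1 (by positivity)
  simpa only [fdiff, e1] using this

theorem norm_fdiff_two_path_le (hH : ContDiffOn ℝ 3 H (Icc 0 1)) {L : ℕ} (hL : 0 < L) {c : ℝ}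
    (hc : ∀ s ∈ Icc (0 : ℝ) 1, ‖pathDeriv 2 H s‖ ≤ c) {j : ℕ} (hj : j + 2 ≤ L) :
    ‖fdiff (fdiff (fun j : ℕ => H ((j : ℝ) / L))) j‖ ≤ c * (1 / L) ^ 2 := by
  have hL' : (0 : ℝ) < L := by exact_mod_cast hL
  have e1 : ((j + 1 : ℕ) : ℝ) / L = (j : ℝ) / L + 1 / L := by push_cast; ring
  have e2 : ((j + 2 : ℕ) : ℝ) / L = (j : ℝ) / L + 2 * (1 / L) := by push_cast; ring
  have h2 : ((j + 2 : ℕ) : ℝ) / L ≤ 1 := by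
    rw [div_le_one hL']; exact_mod_cast hj
  have hj0 : 0 ≤ (j : ℝ) / L := by positivity
  have hL1 : 0 ≤ 1 / (L : ℝ) := by positivity
  rw [e2] at h2
  have := norm_second_difference_le (convex_Icc (0 : ℝ) 1) (F := H)
    (fun s hs => by
      have := hasDerivWithinAt_pathDeriv hH (k := 0) (by norm_num) hs
      rwa [pathDeriv_zero] at this)
    (fun s hs => hasDerivWithinAt_pathDeriv hH (k := 1) (by norm_num) hs) hc
    (s := (j : ℝ) / L) (h := 1 / L) ⟨hj0, by linarith⟩ ⟨by linarith, h2⟩ hL1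
  simpa only [fdiff, add_assoc, Nat.reduceAdd, e1, e2] using this

theorem norm_fdiff_three_path_le (hH : ContDiffOn ℝ 3 H (Icc 0 1)) {L : ℕ} (hL : 0 < L) {c : ℝ}
    (hc : ∀ s ∈ Icc (0 : ℝ) 1, ‖pathDeriv 3 H s‖ ≤ c) {j : ℕ} (hj : j + 3 ≤ L) :
    ‖fdiff (fdiff (fdiff (fun j : ℕ => H ((j : ℝ) / L)))) j‖ ≤ c * (1 / L) ^ 3 := by
  have hL' : (0 : ℝ) < L := by exact_mod_cast hL
  have e1 : ((j + 1 : ℕ) : ℝ) / L = (j : ℝ) / L + 1 / L := by push_cast; ring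
  have e2 : ((j + 2 : ℕ) : ℝ) / L = (j : ℝ) / L + 2 * (1 / L) := by push_cast; ring
  have e3 : ((j + 3 : ℕ) : ℝ) / L = (j : ℝ) / L + 3 * (1 / L) := by push_cast; ring
  have h2 : ((j + 3 : ℕ) : ℝ) / L ≤ 1 := by
    rw [div_le_one hL']; exact_mod_cast hj
  have hj0 : 0 ≤ (j : ℝ) / L := by positivity
  have hL1 : 0 ≤ 1 / (L : ℝ) := by positivity
  rw [e3] at h2
  have := norm_third_difference_le (convex_Icc (0 : ℝ) 1) (F := H)
    (fun s hs => by
      have := hasDerivWithinAt_pathDeriv hH (k := 0) (by norm_num) hs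
      rwa [pathDeriv_zero] at this)
    (fun s hs => hasDerivWithinAt_pathDeriv hH (k := 1) (by norm_num) hs)
    (fun s hs => hasDerivWithinAt_pathDeriv hH (k := 2) (by norm_num) hs) hc
    (s := (j : ℝ) / L) (h := 1 / L) ⟨hj0, by linarith⟩ ⟨by linarith, h2⟩ hL1
  simpa only [fdiff, add_assoc, Nat.reduceAdd, e1, e2, e3] using this

end Path

/-! ### Error bound at fixed `T` and `L` -/

theorem fdiff_smul {N : ℕ} (z : ℂ) (F : ℕ → Op N) :
    fdiff (fun j => z • F j) = fun j => z • fdiff F j := by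
  funext j
  simp only [fdiff, smul_sub]

/-- The differences of the steps `U_j`, in terms of the derivatives of the path. -/
theorem norm_stepOp_differences {N : ℕ} {H : ℝ → Op N} {E : ℝ → Fin N → ℝ}
    (hH : ContDiffOn ℝ 3 H (Icc 0 1)) (hA : ∀ s ∈ Icc (0 : ℝ) 1, IsSelfAdjoint (H s))
    (hE : ∀ s ∈ Icc (0 : ℝ) 1, IsEnergyLevels (H s) (E s)) {T : ℝ} (hT : 0 < T) {L : ℕ}
    (hL : 0 < L) {c₁ c₂ c₃ : ℝ} (h1 : ∀ s ∈ Icc (0 : ℝ) 1, ‖pathDeriv 1 H s‖ ≤ c₁)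
    (h2 : ∀ s ∈ Icc (0 : ℝ) 1, ‖pathDeriv 2 H s‖ ≤ c₂)
    (h3 : ∀ s ∈ Icc (0 : ℝ) 1, ‖pathDeriv 3 H s‖ ≤ c₃) {a₁ a₂ a₃ : ℝ}
    (ha₁ : a₁ = T / L * (c₁ * (1 / L))) (ha₂ : a₂ = T / L * (c₂ * (1 / L) ^ 2))
    (ha₃ : a₃ = T / L * (c₃ * (1 / L) ^ 3)) :
    (∀ j, j + 1 ≤ L → ‖fdiff (stepOp H T L) j‖
      ≤ T / L * ‖fdiff (fun j : ℕ => H ((j : ℝ) / L)) j‖) ∧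
    (∀ j, j + 2 ≤ L → ‖fdiff (fdiff (stepOp H T L)) j‖ ≤ 2 * (a₁ * a₁) + a₂) ∧
    (∀ j, j + 3 ≤ L → ‖fdiff (fdiff (fdiff (stepOp H T L))) j‖
      ≤ 3 * (a₁ * (2 * (a₁ * a₁) + a₂)) + 3 * (a₂ * a₁) + a₃) := by
  have hL' : (0 : ℝ) < L := by exact_mod_cast hL
  have hmem : ∀ j ≤ L, (j : ℝ) / L ∈ Icc (0 : ℝ) 1 := fun j hj =>
    ⟨by positivity, by rw [div_le_one hL']; exact_mod_cast hj⟩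
  have hδ : 0 ≤ T / L := by positivity
  set z : ℂ := -(Complex.I * ((T / L : ℝ) : ℂ)) with hz
  have nz : ‖z‖ = T / L := by
    rw [hz, norm_neg, norm_mul, Complex.norm_I, one_mul, Complex.norm_real, Real.norm_eq_abs,
      abs_of_nonneg hδ]
  set G : ℕ → Op N := fun j => H ((j : ℝ) / L) with hG
  -- Rescaling the exponent by a real `t` only changes the duration of the step, so the exponential
  -- stays a contraction.
  have hcontr : ∀ j ≤ L, ∀ t : ℝ, ‖NormedSpace.exp (t • (z • G j))‖ ≤ 1 := by
    intro j hj t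
    have e : t • (z • G j) = (-(Complex.I * ((t * (T / L) : ℝ) : ℂ))) • G j := by
      have : t • (z • G j) = (t : ℂ) • (z • G j) := rfl
      rw [this, smul_smul, hz]
      congr 1
      push_cast
      ring
    rw [e]
    exact norm_exp_step_le (hA _ (hmem j hj)) (hE _ (hmem j hj)) _
  have key := norm_exp_differences (A := fun j => z • G j) (a₁ := a₁) (a₂ := a₂) (a₃ := a₃) hcontr
    (fun j hj => by
      rw [fdiff_smul, norm_smul, nz, ha₁]
      gcongr
      exact norm_fdiff_path_le hH hL (convex_Icc 0 1) le_rfl h1 (hmem j (by omega)) (hmem _ hj))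
    (fun j hj => by
      rw [fdiff_smul, fdiff_smul, norm_smul, nz, ha₂]
      gcongr
      exact norm_fdiff_two_path_le hH hL h2 hj)
    (fun j hj => by
      rw [fdiff_smul, fdiff_smul, fdiff_smul, norm_smul, nz, ha₃]
      gcongr
      exact norm_fdiff_three_path_le hH hL h3 hj)
  refine ⟨fun j hj => ?_, key.2.1, key.2.2⟩
  have := key.1 j hj
  rwa [fdiff_smul, norm_smul, nz] at this

/-- The non-asymptotic form of the error bound. -/
theorem errorAtMost_of_bounds {d : ℕ} {H : ℝ → Op (d + 2)} {E : ℝ → Fin (d + 2) → ℝ}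
    (hH : ContDiffOn ℝ 3 H (Icc 0 1)) (hA : ∀ s ∈ Icc (0 : ℝ) 1, IsSelfAdjoint (H s))
    (hE : ∀ s ∈ Icc (0 : ℝ) 1, IsEnergyLevels (H s) (E s)) {T : ℝ} (hT : 0 < T) {L : ℕ}
    (hL : 0 < L) (hstep : StepCondition E T L) {Λ σ : ℝ} (hΛ : 0 < Λ) (hσ : 0 ≤ σ)
    (h1 : ∀ s ∈ Icc (0 : ℝ) 1, ‖pathDeriv 1 H s‖ ≤ Λ * σ / 100)
    (h2 : ∀ s ∈ Icc (0 : ℝ) 1, ‖pathDeriv 2 H s‖ ≤ Λ * σ ^ 2 / 100)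
    (h3 : ∀ s ∈ Icc (0 : ℝ) 1, ‖pathDeriv 3 H s‖ ≤ Λ * σ ^ 3 / 100)
    (hgap : ∀ s ∈ Icc (0 : ℝ) 1, Λ ≤ gap (E s)) (hΛT : 8 ≤ Λ * T) (hσT : σ ≤ 0.4 * (Λ * T))
    (hσT2 : 10 ^ 17 * σ ^ 2 ≤ 0.4 * (Λ * T)) {B₀ B₁ l₀ l₁ : ℝ} (hl₀ : 0 < l₀) (hl₁ : 0 < l₁)
    (hB₀ : ∀ s ∈ Icc (0 : ℝ) (2 / L), s ≤ 1 → ‖pathDeriv 1 H s‖ ≤ B₀)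
    (hB₁ : ∀ s ∈ Icc (1 - 2 / L : ℝ) 1, 0 ≤ s → ‖pathDeriv 1 H s‖ ≤ B₁)
    (hg₀ : ∀ s ∈ Icc (0 : ℝ) (2 / L), s ≤ 1 → l₀ ≤ gap (E s))
    (hg₁ : ∀ s ∈ Icc (1 - 2 / L : ℝ) 1, 0 ≤ s → l₁ ≤ gap (E s)) :
    ErrorAtMost H E T L (400 * (B₀ / (T * l₀ ^ 2)) + 400 * (B₁ / (T * l₁ ^ 2))
      + 10 ^ 38 * ((σ ^ 2 + σ ^ 3) / (Λ * T) ^ 2)) := by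
  have hL' : (0 : ℝ) < L := by exact_mod_cast hL
  have hmem : ∀ j ≤ L, (j : ℝ) / L ∈ Icc (0 : ℝ) 1 := fun j hj =>
    ⟨by positivity, by rw [div_le_one hL']; exact_mod_cast hj⟩
  set δ : ℝ := T / L with hδd
  have hδ : 0 < δ := by positivity
  have hgδ : ∀ s ∈ Icc (0 : ℝ) 1, gap (E s) * δ < 3.78 := fun s hs => hstep s hs 1
  have hΛδ : Λ * δ < 3.78 := by
    have h0 : (0 : ℝ) ∈ Icc (0 : ℝ) 1 := by simp
    have : Λ * δ ≤ gap (E 0) * δ := by gcongr; exact hgap 0 h0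
    exact this.trans_lt (hgδ 0 h0)
  -- The depth cannot be tiny: `8 ≤ Λ T = (Λ δ) L < 3.78 L`.
  have hL2 : 2 ≤ L := by
    have e : Λ * T = Λ * δ * L := by rw [hδd]; field_simp
    have : (2 : ℝ) < L := by nlinarith
    exact_mod_cast this.le
  obtain ⟨N, rfl⟩ : ∃ N, L = N + 2 := ⟨L - 2, by omega⟩
  set L : ℕ := N + 2 with hLN
  set γ : ℝ := 0.4 * (Λ * δ) with hγd
  set ρ : ℝ := σ / L with hρd
  have hγ : 0 < γ := by positivity
  have hγ2 : γ ≤ 2 := by linarith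
  have hρ : 0 ≤ ρ := by positivity
  have hργ : ρ ≤ γ := by
    have e : γ = 0.4 * (Λ * T) / L := by rw [hγd, hδd]; ring
    rw [e, hρd]
    gcongr
  have ex : ∀ j, ∃ P S : Op (d + 2), j ≤ L →
      IsReducedResolvent (stepOp H T L j) P S
        (Complex.exp (-(Complex.I * δ) * E ((j : ℝ) / L) 0)) ∧
      ‖S‖ ≤ 1 / (0.4 * (gap (E ((j : ℝ) / L)) * δ)) ∧ ‖P‖ ≤ 1 ∧ ‖1 - P‖ ≤ 1 ∧
      (∀ ψ, IsEigenstate (H ((j : ℝ) / L)) (E ((j : ℝ) / L) 0) ψ → P ψ = ψ) ∧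
      (∀ ψ x, IsEigenstate (H ((j : ℝ) / L)) (E ((j : ℝ) / L) 0) ψ → ‖x‖ = 1 →
        1 - ‖inner ℂ ψ x‖ ^ 2 = ‖(1 - P) x‖ ^ 2) := by
    intro j
    by_cases hj : j ≤ L
    · obtain ⟨P, S, h⟩ := exists_ground_projection (hA _ (hmem j hj)) (hE _ (hmem j hj)) hδ
        (hstep _ (hmem j hj))
      exact ⟨P, S, fun _ => h⟩
    · exact ⟨0, 0, fun h => absurd h hj⟩
  choose P S hPS using ex
  have hSle : ∀ j ≤ L, ∀ l : ℝ, 0 < l → l ≤ gap (E ((j : ℝ) / L)) →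
      ‖S j‖ ≤ 1 / (0.4 * (l * δ)) := by
    intro j hj l hl hlg
    refine (hPS j hj).2.1.trans ?_
    gcongr
  have hsg : ∀ j ≤ L, ∀ l : ℝ, 0 < l → l ≤ gap (E ((j : ℝ) / L)) →
      SpectralGap (stepOp H T L j) (P j) (0.4 * (l * δ)) := by
    intro j hj l hl hlg
    exact (hPS j hj).1.spectralGap (by positivity) (hSle j hj l hl hlg) (hPS j hj).2.2.1
      (hPS j hj).2.2.2.1
  -- `δ · Λ σᵏ/100 · L⁻ᵏ = γ ρᵏ/40`, because `γ = 0.4 Λ δ` and `ρ = σ/L`.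
  have diffs := norm_stepOp_differences hH hA hE hT hL h1 h2 h3 (a₁ := γ * ρ / 40)
    (a₂ := γ * ρ ^ 2 / 40) (a₃ := γ * ρ ^ 3 / 40)
    (by rw [hγd, hρd]; ring) (by rw [hγd, hρd]; ring) (by rw [hγd, hρd]; ring)
  have hdP : ∀ j, j + 1 ≤ L → ∀ l c : ℝ, 0 < l → l ≤ gap (E ((j : ℝ) / L)) →
      l ≤ gap (E (((j + 1 : ℕ) : ℝ) / L)) →
      ‖fdiff (fun j : ℕ => H ((j : ℝ) / L)) j‖ ≤ c * (1 / L) →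
      ‖P (j + 1) - P j‖ ≤ 10 * (c * (1 / L) / l) := by
    intro j hj l c hl hlg hlg' hc
    have hu : ‖Complex.exp (-(Complex.I * δ) * E (((j + 1 : ℕ) : ℝ) / L) 0)
        - Complex.exp (-(Complex.I * δ) * E ((j : ℝ) / L) 0)‖ ≤ δ * (c * (1 / L)) := by
      refine (norm_exp_sub_exp_le _ _ hδ.le).trans ?_
      gcongr
      exact abs_ground_energy_sub_le (hA _ (hmem j (by omega))) (hE _ (hmem j (by omega)))
        (hA _ (hmem _ hj)) (hE _ (hmem _ hj)) hc
    have hU : ‖stepOp H T L (j + 1) - stepOp H T L j‖ ≤ δ * (c * (1 / L)) :=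
      (diffs.1 j hj).trans (by gcongr)
    refine ((hPS j (by omega)).1.norm_sub_le (hPS (j + 1) hj).1 (γ := 0.4 * (l * δ))
      (γ' := 0.4 * (l * δ)) (by positivity) (by positivity) (hSle j (by omega) l hl hlg)
      (hSle (j + 1) hj l hl hlg') (hPS j (by omega)).2.2.1 (hPS (j + 1) hj).2.2.1
      hU hu).trans (le_of_eq ?_)
    field_simp
    ring
  have hG : GappedSequence (N + 2) γ ρ (stepOp H T L) P :=
    { γ_pos := hγ
      γ_le := hγ2
      ρ_nonneg := hρ
      ρ_le := hργ
      norm_U := fun j hj => norm_exp_step_le (hA _ (hmem j hj)) (hE _ (hmem j hj)) _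
      norm_P := fun j hj => (hPS j hj).2.2.1
      norm_Q := fun j hj => (hPS j hj).2.2.2.1
      idem := fun j hj => (hPS j hj).1.idem
      comm := fun j hj => (hPS j hj).1.U_mul_P.trans (hPS j hj).1.P_mul_U.symm
      gap := fun j hj => hsg j hj Λ hΛ (hgap _ (hmem j hj))
      diff_U := fun j hj => by
        have k := norm_fdiff_path_le hH hL (convex_Icc 0 1) le_rfl h1 (hmem j (by omega))
          (hmem _ hj)
        have k2 : δ * ‖fdiff (fun j : ℕ => H ((j : ℝ) / L)) j‖ ≤ δ * (Λ * σ / 100 * (1 / L)) := by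
          gcongr
        have k3 : δ * (Λ * σ / 100 * (1 / L)) = γ * ρ / 40 := by rw [hγd, hρd]; ring
        have k4 : 0 ≤ γ * ρ := by positivity
        have := diffs.1 j hj
        linarith
      diff_two_U := fun j hj => by
        refine (diffs.2.1 j hj).trans ?_
        have k1 : γ * (γ * ρ ^ 2) ≤ 2 * (γ * ρ ^ 2) := by gcongr
        have k2 : 0 ≤ γ * ρ ^ 2 := by positivity
        nlinarith
      diff_three_U := fun j hj => by
        refine (diffs.2.2 j hj).trans ?_
        have k2 : 0 ≤ γ * ρ ^ 3 := by positivity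
        have k1 : γ * (γ * ρ ^ 3) ≤ 2 * (γ * ρ ^ 3) := by gcongr
        have k3 : γ * (γ * (γ * ρ ^ 3)) ≤ 2 * (2 * (γ * ρ ^ 3)) := by gcongr
        nlinarith
      diff_P := fun j hj => by
        have k := norm_fdiff_path_le hH hL (convex_Icc 0 1) le_rfl h1 (hmem j (by omega))
          (hmem _ hj)
        refine (hdP j hj Λ _ hΛ (hgap _ (hmem j (by omega))) (hgap _ (hmem _ hj)) k).trans ?_
        have e : 10 * (Λ * σ / 100 * (1 / L) / Λ) = ρ / 10 := by
          rw [hρd]; field_simp; ring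
        rw [e]
        linarith }
  intro ψi ψf hi hf
  set x : ℕ → State (d + 2) := fun j => partialPropagator H T L j ψi with hx
  have xs : ∀ j, x (j + 1) = stepOp H T L (j + 1) (x j) := fun j => rfl
  have xn : ∀ j ≤ L, ‖x j‖ = 1 := by
    intro j
    induction j with
    | zero => intro _; exact hi.1
    | succ j ih =>
      intro hj
      rw [xs, ← ih (by omega)]
      exact norm_exp_step_apply (hA _ (hmem _ hj)) (hE _ (hmem _ hj)) _ _
  have hLL : ((L : ℕ) : ℝ) / L = 1 := div_self hL'.ne'
  have h0L : ((0 : ℕ) : ℝ) / L = 0 := by simp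
  have hfid : fidelityError H T L ψi ψf = ‖(1 - P L) (x L)‖ := by
    rw [fidelityError, ← Real.sqrt_sq (norm_nonneg ((1 - P L) (x L)))]
    congr 1
    refine (hPS L le_rfl).2.2.2.2.2 ψf (x L) ?_ (xn L le_rfl)
    rwa [hLL]
  have hx0 : P 0 (x 0) = x 0 := by
    refine (hPS 0 (by omega)).2.2.2.2.1 _ ?_
    rw [h0L]
    exact hi
  have near0 : ∀ j : ℕ, j ≤ 2 → (j : ℝ) / L ∈ Icc (0 : ℝ) (2 / L) := fun j hj =>
    ⟨by positivity, by gcongr; exact_mod_cast hj⟩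
  have near1 : ∀ j : ℕ, j ≤ L → N ≤ j → (j : ℝ) / L ∈ Icc (1 - 2 / L : ℝ) 1 := fun j hj hN =>
    ⟨by
      rw [← hLL, ← sub_div]
      gcongr
      rw [hLN]
      push_cast
      have : (N : ℝ) ≤ j := by exact_mod_cast hN
      linarith, (hmem j hj).2⟩
  have gap0 : ∀ j : ℕ, j ≤ 2 → l₀ ≤ gap (E ((j : ℝ) / L)) := fun j hj =>
    hg₀ _ (near0 j hj) (hmem j (by omega)).2
  have gap1 : ∀ j : ℕ, j ≤ L → N ≤ j → l₁ ≤ gap (E ((j : ℝ) / L)) := fun j hj hN =>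
    hg₁ _ (near1 j hj hN) (hmem j (by omega)).1
  have dP0 : ∀ j, j ≤ 1 → ‖P (j + 1) - P j‖ ≤ 10 * (B₀ * (1 / L) / l₀) := by
    intro j hj
    refine hdP j (by omega) l₀ B₀ hl₀ (gap0 j (by omega)) (gap0 (j + 1) (by omega)) ?_
    exact norm_fdiff_path_le hH hL (S := Icc 0 (2 / L) ∩ Icc 0 1)
      ((convex_Icc _ _).inter (convex_Icc _ _)) inter_subset_right
      (fun s hs => hB₀ s hs.1 hs.2.2) ⟨near0 j (by omega), hmem j (by omega)⟩
      ⟨near0 (j + 1) (by omega), hmem (j + 1) (by omega)⟩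
  have dP1 : ‖P (N + 2) - P (N + 1)‖ ≤ 10 * (B₁ * (1 / L) / l₁) := by
    refine hdP (N + 1) (by omega) l₁ B₁ hl₁ (gap1 (N + 1) (by omega) (by omega))
      (gap1 (N + 2) (by omega) (by omega)) ?_
    exact norm_fdiff_path_le hH hL (S := Icc (1 - 2 / L) 1 ∩ Icc 0 1)
      ((convex_Icc _ _).inter (convex_Icc _ _)) inter_subset_right
      (fun s hs => hB₁ s hs.1 hs.2.1)
      ⟨near1 (N + 1) (by omega) (by omega), hmem (N + 1) (by omega)⟩
      ⟨near1 (N + 2) (by omega) (by omega), hmem (N + 2) (by omega)⟩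
  -- The depth `L` cancels here, so the remainder is uniform in `L`.
  have hργe : ρ / γ = σ / (0.4 * (Λ * T)) := by
    rw [hγd, hρd, hδd]
    field_simp
  have hNL : (N : ℝ) ≤ L := by rw [hLN]; push_cast; linarith
  have hNρ : N * ρ ≤ σ := by
    have : (L : ℝ) * ρ = σ := by rw [hρd]; field_simp
    rw [← this]
    gcongr
  have main := hG.norm_transition_le x xs (fun j hj => (xn j hj).le) hx0
    (γ₀ := 0.4 * (l₀ * δ)) (γ₁ := 0.4 * (l₁ * δ)) (by positivity)
    (hsg 2 (by omega) l₀ hl₀ (gap0 2 le_rfl)) (by positivity)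
    (hsg (N + 2) le_rfl l₁ hl₁ (gap1 (N + 2) le_rfl (by omega))) (by
      have e : (N : ℝ) * (10 ^ 17 * (ρ / γ) * ρ) = 10 ^ 17 * (ρ / γ) * (N * ρ) := by ring
      rw [e]
      calc 10 ^ 17 * (ρ / γ) * (N * ρ) ≤ 10 ^ 17 * (ρ / γ) * σ := by gcongr
        _ = 10 ^ 17 * σ ^ 2 / (0.4 * (Λ * T)) := by rw [hργe]; ring
        _ ≤ 1 := by rw [div_le_one (by positivity)]; exact hσT2)
  rw [hfid]
  refine main.trans ?_
  have hB0 : 0 ≤ B₀ := (norm_nonneg _).trans (hB₀ 0 ⟨le_rfl, by positivity⟩ zero_le_one)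
  have hB1 : 0 ≤ B₁ := (norm_nonneg _).trans (hB₁ 1 ⟨by
    have : (0 : ℝ) ≤ 2 / L := by positivity
    linarith, le_rfl⟩ zero_le_one)
  -- This turns the losses `B₀/(L l₀) = (l₀ δ) B₀/(T l₀²)` of the first two steps into the same form
  -- as the tilt. In the tilt `δ` cancels by itself.
  have hl0δ : l₀ * δ ≤ 3.78 := by
    have := hgδ 0 (by simp)
    have k := gap0 0 (by omega)
    rw [h0L] at k
    have : l₀ * δ ≤ gap (E 0) * δ := by gcongr
    linarith
  have hhL : (1 : ℝ) / L = δ / T := by rw [hδd]; field_simp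
  have t0 : ‖P 1 - P 0‖ ≤ 38 * (B₀ / (T * l₀ ^ 2)) := by
    refine (dP0 0 (by omega)).trans ?_
    rw [hhL]
    have e : 10 * (B₀ * (δ / T) / l₀) = 10 * (l₀ * δ) * (B₀ / (T * l₀ ^ 2)) := by field_simp
    rw [e]
    gcongr
    linarith
  have t1 : ‖P 2 - P 1‖ ≤ 38 * (B₀ / (T * l₀ ^ 2)) := by
    refine (dP0 1 le_rfl).trans ?_
    rw [hhL]
    have e : 10 * (B₀ * (δ / T) / l₀) = 10 * (l₀ * δ) * (B₀ / (T * l₀ ^ 2)) := by field_simp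
    rw [e]
    gcongr
    linarith
  have t2 : ‖P 2 - P 1‖ / (0.4 * (l₀ * δ)) ≤ 25 * (B₀ / (T * l₀ ^ 2)) := by
    rw [div_le_iff₀ (by positivity)]
    refine (dP0 1 le_rfl).trans (le_of_eq ?_)
    rw [hhL]
    field_simp
    ring
  have t3 : ‖P (N + 2) - P (N + 1)‖ / (0.4 * (l₁ * δ)) ≤ 25 * (B₁ / (T * l₁ ^ 2)) := by
    rw [div_le_iff₀ (by positivity)]
    refine dP1.trans (le_of_eq ?_)
    rw [hhL]
    field_simp
    ring
  have t4 : (ρ / γ) ^ 2 = 6.25 * (σ ^ 2 / (Λ * T) ^ 2) := by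
    rw [hργe]
    field_simp
    ring
  have t5 : N * (10 ^ 36 * ρ * (ρ / γ) ^ 2) ≤ 10 ^ 36 * (6.25 * (σ ^ 3 / (Λ * T) ^ 2)) := by
    rw [t4]
    calc N * (10 ^ 36 * ρ * (6.25 * (σ ^ 2 / (Λ * T) ^ 2)))
        = 10 ^ 36 * (N * ρ) * (6.25 * (σ ^ 2 / (Λ * T) ^ 2)) := by ring
      _ ≤ 10 ^ 36 * σ * (6.25 * (σ ^ 2 / (Λ * T) ^ 2)) := by gcongr
      _ = _ := by ring
  have p0 : 0 ≤ B₀ / (T * l₀ ^ 2) := by positivity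
  have p1 : 0 ≤ B₁ / (T * l₁ ^ 2) := by positivity
  have p2 : 0 ≤ σ ^ 2 / (Λ * T) ^ 2 := by positivity
  have p3 : 0 ≤ σ ^ 3 / (Λ * T) ^ 2 := by positivity
  rw [add_div]
  linarith

/-! ### Asymptotics in `T` -/

theorem ErrorAtMost.mono {d : ℕ} {H : ℝ → Op (d + 2)} {E : ℝ → Fin (d + 2) → ℝ} {T : ℝ} {L : ℕ}
    {B B' : ℝ} (h : ErrorAtMost H E T L B) (hB : B ≤ B') : ErrorAtMost H E T L B' :=
  fun ψi ψf hi hf => (h ψi ψf hi hf).trans hB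

theorem gap_le_gap_add_path {d : ℕ} {H : ℝ → Op (d + 2)} {E : ℝ → Fin (d + 2) → ℝ}
    (hH : ContDiffOn ℝ 3 H (Icc 0 1)) (hA : ∀ s ∈ Icc (0 : ℝ) 1, IsSelfAdjoint (H s))
    (hE : ∀ s ∈ Icc (0 : ℝ) 1, IsEnergyLevels (H s) (E s)) {K : ℝ}
    (h1 : ∀ s ∈ Icc (0 : ℝ) 1, ‖pathDeriv 1 H s‖ ≤ K) {s t : ℝ} (hs : s ∈ Icc (0 : ℝ) 1)
    (ht : t ∈ Icc (0 : ℝ) 1) : gap (E t) ≤ gap (E s) + 2 * (K * |t - s|) := by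
  refine gap_le_gap_add (hA s hs) (hE s hs) (hA t ht) (hE t ht) ?_
  refine (convex_Icc (0 : ℝ) 1).norm_image_sub_le_of_norm_hasDerivWithin_le
    (fun x hx => ?_) h1 hs ht
  have := hasDerivWithinAt_pathDeriv hH (k := 0) (by norm_num) hx
  rwa [pathDeriv_zero] at this

theorem norm_pathDeriv_one_le {N : ℕ} {H : ℝ → Op N} (hH : ContDiffOn ℝ 3 H (Icc 0 1)) {c : ℝ}
    (h2 : ∀ s ∈ Icc (0 : ℝ) 1, ‖pathDeriv 2 H s‖ ≤ c) {s t : ℝ} (hs : s ∈ Icc (0 : ℝ) 1)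
    (ht : t ∈ Icc (0 : ℝ) 1) : ‖pathDeriv 1 H t‖ ≤ ‖pathDeriv 1 H s‖ + c * |t - s| := by
  have := (convex_Icc (0 : ℝ) 1).norm_image_sub_le_of_norm_hasDerivWithin_le
    (fun x hx => hasDerivWithinAt_pathDeriv hH (k := 1) (by norm_num) hx) h2 hs ht
  have k := norm_le_norm_add_norm_sub' (pathDeriv 1 H t) (pathDeriv 1 H s)
  exact k.trans (by rw [Real.norm_eq_abs] at this; linarith)

/-- The error bound in terms of the parameter `σ = (θ T) ^ (1 / 3)`, once `σ` and `T` are large. -/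
theorem errorAtMost_endpointMax {d : ℕ} {H : ℝ → Op (d + 2)} {E : ℝ → Fin (d + 2) → ℝ}
    (hH : ContDiffOn ℝ 3 H (Icc 0 1)) (hA : ∀ s ∈ Icc (0 : ℝ) 1, IsSelfAdjoint (H s))
    (hE : ∀ s ∈ Icc (0 : ℝ) 1, IsEnergyLevels (H s) (E s)) {T : ℝ} (hT : 0 < T) {L : ℕ}
    (hL : 0 < L) (hstep : StepCondition E T L) {K g q η θ σ : ℝ} (hg : 0 < g) (hK : 0 ≤ K)
    (hq : q = 1 + 2 * K / g) (hη : 0 < η) (hθ : θ = η / (10 ^ 38 * q ^ 2)) (hσ3 : σ ^ 3 = θ * T)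
    (h1 : ∀ s ∈ Icc (0 : ℝ) 1, ‖pathDeriv 1 H s‖ ≤ K)
    (h2 : ∀ s ∈ Icc (0 : ℝ) 1, ‖pathDeriv 2 H s‖ ≤ Real.sqrt T)
    (h3 : ∀ s ∈ Icc (0 : ℝ) 1, ‖pathDeriv 3 H s‖ ≤ g / q * θ / 100 * T)
    (hgap : ∀ s ∈ Icc (0 : ℝ) 1, g ≤ gap (E s)) (hσ1 : 1 ≤ σ) (hσK : 100 * K ≤ g / q * σ)
    (hσ2 : 100 ^ 2 ≤ θ * (g / q) ^ 2 * σ) (hσθ : θ ≤ 0.4 * (g / q) * σ)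
    (hσθ' : 10 ^ 17 * θ ≤ 0.4 * (g / q) * σ) (hTg : 8 ≤ g / q * T)
    (hTη : 16 ≤ g * η * Real.sqrt T) (hTK : 32 * K ≤ g ^ 2 * T) :
    ErrorAtMost H E T L (3200 * endpointMax (fun s => ‖pathDeriv 1 H s‖ + η) E T) := by
  have hL' : (0 : ℝ) < L := by exact_mod_cast hL
  have m0 : (0 : ℝ) ∈ Icc (0 : ℝ) 1 := by simp
  have m1 : (1 : ℝ) ∈ Icc (0 : ℝ) 1 := by simp
  have hq1 : 1 ≤ q := by
    have : 0 ≤ 2 * K / g := by positivity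
    linarith
  have hq0 : 0 < q := by linarith
  have hθ0 : 0 < θ := by rw [hθ]; positivity
  have hσ0 : 0 < σ := by linarith
  set g₀ : ℝ := g / q with hg₀
  have hg₀p : 0 < g₀ := by positivity
  -- The gap varies along the path by at most `2 K ≤ (q - 1) gap`, so this is a lower bound for it
  -- everywhere. Using it instead of `g` leaves `gap (E 0) ^ 2` in the remainder, as the conclusion
  -- requires.
  set Λ : ℝ := gap (E 0) / q with hΛ
  have hl0 : 0 < gap (E 0) := hg.trans_le (hgap 0 m0)
  have hl1 : 0 < gap (E 1) := hg.trans_le (hgap 1 m1)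
  have hΛg : g₀ ≤ Λ := by rw [hg₀, hΛ]; gcongr; exact hgap 0 m0
  have hΛp : 0 < Λ := hg₀p.trans_le hΛg
  have hΛs : ∀ s ∈ Icc (0 : ℝ) 1, Λ ≤ gap (E s) := by
    intro s hs
    rw [hΛ, div_le_iff₀ hq0, hq]
    have k1 := gap_le_gap_add_path hH hA hE h1 hs m0
    have k2 : K * |0 - s| ≤ K * 1 := by
      gcongr
      rw [zero_sub, abs_neg, abs_of_nonneg hs.1]
      exact hs.2
    have k3 : 2 * K ≤ gap (E s) * (2 * K / g) := by
      rw [← mul_div_assoc, le_div_iff₀ hg, mul_comm]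
      gcongr
      exact hgap s hs
    linarith
  have hTσ : T = σ ^ 3 / θ := by rw [hσ3]; field_simp
  have hsqrt : Real.sqrt T ≤ g₀ * σ ^ 2 / 100 := by
    rw [Real.sqrt_le_left (by positivity), hTσ, div_le_iff₀ hθ0]
    have : σ ^ 3 * 100 ^ 2 ≤ σ ^ 3 * (θ * g₀ ^ 2 * σ) := by gcongr
    linarith
  -- The step condition itself forces depth at least linear in `T`. Hence within two steps of an
  -- endpoint `H'` moves by at most `√T · 2/L ≤ η/2`, and the gap loses at most half its value.
  have hLlow : g * T ≤ 3.78 * L := by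
    have k := hstep 0 m0 1
    have k2 := hgap 0 m0
    have k3 : g * (T / L) ≤ gap (E 0) * (T / L) := by gcongr
    have k4 : g * (T / L) ≤ 3.78 := k3.trans k.le
    rw [← mul_div_assoc, div_le_iff₀ hL'] at k4
    exact k4
  have hinv : (2 : ℝ) / L ≤ 7.56 / (g * T) := by
    rw [div_le_div_iff₀ hL' (by positivity)]
    linarith
  have hsq : 0 < Real.sqrt T := Real.sqrt_pos.2 hT
  have hloc : Real.sqrt T * (2 / L) ≤ η / 2 := by
    calc Real.sqrt T * (2 / L) ≤ Real.sqrt T * (7.56 / (g * T)) := by gcongr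
      _ = 7.56 / (g * Real.sqrt T) := by
        rw [mul_div_assoc', div_eq_div_iff (by positivity) (by positivity)]
        have := Real.mul_self_sqrt hT.le
        linear_combination (7.56 * g) * this
      _ ≤ η / 2 := by
        rw [div_le_div_iff₀ (by positivity) two_pos]
        linarith
  have hloc' : ∀ r, r ≤ 2 / (L : ℝ) → 2 * (K * r) ≤ g / 2 := by
    intro r hr
    have : K * r ≤ K * (7.56 / (g * T)) := by
      gcongr
      exact hr.trans hinv
    have k : K * (7.56 / (g * T)) ≤ g / 4 := by
      rw [mul_div_assoc', div_le_div_iff₀ (by positivity) (by norm_num)]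
      have : K * 7.56 * 4 ≤ 32 * K := by linarith
      linarith
    linarith
  have near : ∀ e ∈ Icc (0 : ℝ) 1, ∀ s ∈ Icc (0 : ℝ) 1, |s - e| ≤ 2 / L →
      ‖pathDeriv 1 H s‖ ≤ ‖pathDeriv 1 H e‖ + η / 2 ∧ gap (E e) / 2 ≤ gap (E s) := by
    intro e he s hs hse
    constructor
    · refine (norm_pathDeriv_one_le hH h2 he hs).trans ?_
      have : Real.sqrt T * |s - e| ≤ Real.sqrt T * (2 / L) := by gcongr
      linarith
    · have k1 := gap_le_gap_add_path hH hA hE h1 hs he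
      rw [abs_sub_comm] at k1
      have := hloc' _ hse
      have := hgap e he
      linarith
  have main := errorAtMost_of_bounds hH hA hE hT hL hstep (Λ := Λ) (σ := σ) hΛp hσ0.le
    (fun s hs => (h1 s hs).trans (by
      have : g₀ * σ ≤ Λ * σ := by gcongr
      linarith))
    (fun s hs => (h2 s hs).trans (hsqrt.trans (by gcongr)))
    (fun s hs => (h3 s hs).trans (by
      have : g₀ * σ ^ 3 ≤ Λ * σ ^ 3 := by gcongr
      rw [hσ3] at this
      rw [hσ3]
      linarith)) hΛs
    (hTg.trans (by gcongr))
    (by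
      have k : g₀ * T ≤ Λ * T := by gcongr
      have k2 : σ ≤ 0.4 * (g₀ * T) := by
        rw [hTσ, mul_div_assoc', mul_div_assoc', le_div_iff₀ hθ0]
        have k3 : σ * θ ≤ σ * (0.4 * g₀ * σ) := by gcongr
        have k4 : 0.4 * g₀ * σ ^ 2 * 1 ≤ 0.4 * g₀ * σ ^ 2 * σ := by gcongr
        linarith
      linarith)
    (by
      have k : g₀ * T ≤ Λ * T := by gcongr
      have k2 : 10 ^ 17 * σ ^ 2 ≤ 0.4 * (g₀ * T) := by
        rw [hTσ, mul_div_assoc', mul_div_assoc', le_div_iff₀ hθ0]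
        have k3 : σ ^ 2 * (10 ^ 17 * θ) ≤ σ ^ 2 * (0.4 * g₀ * σ) := by gcongr
        linarith
      linarith)
    (B₀ := ‖pathDeriv 1 H 0‖ + η / 2) (B₁ := ‖pathDeriv 1 H 1‖ + η / 2)
    (l₀ := gap (E 0) / 2) (l₁ := gap (E 1) / 2) (by positivity) (by positivity)
    (fun s hs h => (near 0 m0 s ⟨hs.1, h⟩ (by rw [sub_zero, abs_of_nonneg hs.1]; exact hs.2)).1)
    (fun s hs h => (near 1 m1 s ⟨h, hs.2⟩ (by
      rw [abs_sub_comm, abs_of_nonneg (by linarith [hs.2])]; linarith [hs.1])).1)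
    (fun s hs h => (near 0 m0 s ⟨hs.1, h⟩ (by rw [sub_zero, abs_of_nonneg hs.1]; exact hs.2)).2)
    (fun s hs h => (near 1 m1 s ⟨h, hs.2⟩ (by
      rw [abs_sub_comm, abs_of_nonneg (by linarith [hs.2])]; linarith [hs.1])).2)
  refine main.mono ?_
  -- Here `σ³ = θ T`, and the factors `10 ^ 38` and `q ^ 2` in the definition of `θ` cancel against
  -- the constant of the error bound and against `Λ = gap (E 0) / q`.
  have rem : 10 ^ 38 * ((σ ^ 2 + σ ^ 3) / (Λ * T) ^ 2) ≤ 2 * (η / (T * gap (E 0) ^ 2)) := by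
    have k : σ ^ 2 + σ ^ 3 ≤ 2 * σ ^ 3 := by
      have : σ ^ 2 * 1 ≤ σ ^ 2 * σ := by gcongr
      linarith
    calc 10 ^ 38 * ((σ ^ 2 + σ ^ 3) / (Λ * T) ^ 2)
        ≤ 10 ^ 38 * (2 * σ ^ 3 / (Λ * T) ^ 2) := by gcongr
      _ = 2 * (η / (T * gap (E 0) ^ 2)) := by
        rw [hσ3, hθ, hΛ]
        field_simp
  -- Halving the endpoint gap costs a factor `4`. Keeping only `η/2` near the endpoint leaves a
  -- surplus `800 η`, which pays for the remainder.
  have e0 : 400 * ((‖pathDeriv 1 H 0‖ + η / 2) / (T * (gap (E 0) / 2) ^ 2))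
      = 1600 * ((‖pathDeriv 1 H 0‖ + η) / (T * gap (E 0) ^ 2))
        - 800 * (η / (T * gap (E 0) ^ 2)) := by
    field_simp
    ring
  have e1 : 400 * ((‖pathDeriv 1 H 1‖ + η / 2) / (T * (gap (E 1) / 2) ^ 2))
      = 1600 * ((‖pathDeriv 1 H 1‖ + η) / (T * gap (E 1) ^ 2))
        - 800 * (η / (T * gap (E 1) ^ 2)) := by
    field_simp
    ring
  have p0 : 0 ≤ η / (T * gap (E 0) ^ 2) := by positivity
  have p1 : 0 ≤ η / (T * gap (E 1) ^ 2) := by positivity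
  have M0 : (‖pathDeriv 1 H 0‖ + η) / (T * gap (E 0) ^ 2)
      ≤ endpointMax (fun s => ‖pathDeriv 1 H s‖ + η) E T := le_max_left _ _
  have M1 : (‖pathDeriv 1 H 1‖ + η) / (T * gap (E 1) ^ 2)
      ≤ endpointMax (fun s => ‖pathDeriv 1 H s‖ + η) E T := le_max_right _ _
  linarith

/-- The error bound up to terms of lower order. -/
theorem eventually_errorAtMost {d : ℕ} {H : ℝ → ℝ → Op (d + 2)} {E : ℝ → ℝ → Fin (d + 2) → ℝ}
    (hH : ∀ T > 0, ContDiffOn ℝ 3 (H T) (Icc 0 1))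
    (hA : ∀ T > 0, ∀ s ∈ Icc (0 : ℝ) 1, IsSelfAdjoint (H T s))
    (hE : ∀ T > 0, ∀ s ∈ Icc (0 : ℝ) 1, IsEnergyLevels (H T s) (E T s)) {K g : ℝ} (hK : 0 ≤ K)
    (hg : 0 < g) (h1 : ∀ᶠ T in atTop, ∀ s ∈ Icc (0 : ℝ) 1, ‖pathDeriv 1 (H T) s‖ ≤ K)
    (h2 : ∀ ε > 0, ∀ᶠ T in atTop, ∀ s ∈ Icc (0 : ℝ) 1, ‖pathDeriv 2 (H T) s‖ ≤ ε * Real.sqrt T)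
    (h3 : ∀ ε > 0, ∀ᶠ T in atTop, ∀ s ∈ Icc (0 : ℝ) 1, ‖pathDeriv 3 (H T) s‖ ≤ ε * T)
    (hgap : ∀ᶠ T in atTop, ∀ s ∈ Icc (0 : ℝ) 1, g ≤ gap (E T s)) {η : ℝ} (hη : 0 < η) :
    ∀ᶠ T in atTop, ∀ L : ℕ, 0 < L → StepCondition (E T) T L →
      ErrorAtMost (H T) (E T) T L
        (3200 * endpointMax (fun s => ‖pathDeriv 1 (H T) s‖ + η) (E T) T) := by
  set q : ℝ := 1 + 2 * K / g with hq
  have hq0 : 0 < q := by positivity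
  set θ : ℝ := η / (10 ^ 38 * q ^ 2) with hθ
  have hθ0 : 0 < θ := by positivity
  have hg₀ : 0 < g / q := by positivity
  -- With `σ = (θ T)^(1/3)`, the third derivative fits exactly under `Λ σ³/100` once it is below a
  -- suitable multiple of `T`. The other requirements hold with room to spare, since `σ` grows
  -- beyond every constant and `σ²` faster than `√T`.
  have hσ : Tendsto (fun T : ℝ => (θ * T) ^ ((3 : ℕ) : ℝ)⁻¹) atTop atTop :=
    (tendsto_rpow_atTop (by norm_num)).comp (tendsto_id.const_mul_atTop hθ0)
  have large : ∀ {f : ℝ → ℝ}, Tendsto f atTop atTop → ∀ {a : ℝ}, 0 < a → ∀ b : ℝ,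
      ∀ᶠ T in atTop, b ≤ a * f T := fun hf a ha b =>
    (hf.const_mul_atTop ha).eventually_ge_atTop b
  filter_upwards [h1, h2 1 one_pos, h3 (g / q * θ / 100) (by positivity), hgap,
    eventually_gt_atTop 0, hσ.eventually_ge_atTop 1, large hσ hg₀ (100 * K),
    large hσ (a := θ * (g / q) ^ 2) (by positivity) (100 ^ 2),
    large hσ (a := 0.4 * (g / q)) (by positivity) θ,
    large hσ (a := 0.4 * (g / q)) (by positivity) (10 ^ 17 * θ),
    large tendsto_id hg₀ 8, large Real.tendsto_sqrt_atTop (a := g * η) (by positivity) 16,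
    large tendsto_id (a := g ^ 2) (by positivity) (32 * K)]
    with T h1 h2 h3 hgap hT hσ1 hσK hσ2 hσθ hσθ' hTg hTη hTK L hL hstep
  refine errorAtMost_endpointMax (hH T hT) (hA T hT) (hE T hT) hT hL hstep hg hK hq hη hθ
    (Real.rpow_inv_natCast_pow (by positivity) (by norm_num)) h1 (fun s hs => ?_) h3 hgap hσ1 hσK
    hσ2 hσθ hσθ' hTg hTη hTK
  simpa using h2 s hs

/-- Only one endpoint need have `H'` bounded below by `κ`. The gaps at the two endpoints agree up to
the factor `q`, so the extra term `κ/q²` at either endpoint is dominated by the main term at the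
good one. -/
theorem endpointMax_add_le {d : ℕ} {E : ℝ → Fin (d + 2) → ℝ} {T q κ n₀ n₁ : ℝ} {a : ℝ → ℝ}
    (hT : 0 < T) (hq : 1 ≤ q) (hκ : 0 < κ) (h0 : 0 < gap (E 0)) (h1 : 0 < gap (E 1))
    (h01 : gap (E 0) ≤ q * gap (E 1)) (h10 : gap (E 1) ≤ q * gap (E 0)) (hn₀ : a 0 = n₀)
    (hn₁ : a 1 = n₁) (hmax : κ ≤ max n₀ n₁) :
    endpointMax (fun s => a s + κ / q ^ 2) E T ≤ 2 * endpointMax a E T := by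
  have hq0 : 0 < q := by linarith
  have key : ∀ {x y n : ℝ}, 0 < x → 0 < y → x ≤ q * y → κ ≤ n →
      κ / q ^ 2 / (T * y ^ 2) ≤ n / (T * x ^ 2) := by
    intro x y n hx hy hxy hn
    rw [div_div, div_le_div_iff₀ (by positivity) (by positivity)]
    calc κ * (T * x ^ 2) ≤ n * (T * (q * y) ^ 2) := by gcongr; exact hκ.le.trans hn
      _ = n * (q ^ 2 * (T * y ^ 2)) := by ring
  have self : ∀ {x : ℝ}, 0 < x → x ≤ q * x := fun hx => le_mul_of_one_le_left hx.le hq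
  have m0 : n₀ / (T * gap (E 0) ^ 2) ≤ endpointMax a E T := by
    rw [← hn₀]; exact le_max_left _ _
  have m1 : n₁ / (T * gap (E 1) ^ 2) ≤ endpointMax a E T := by
    rw [← hn₁]; exact le_max_right _ _
  have extra : κ / q ^ 2 / (T * gap (E 0) ^ 2) ≤ endpointMax a E T ∧
      κ / q ^ 2 / (T * gap (E 1) ^ 2) ≤ endpointMax a E T := by
    rcases le_max_iff.1 hmax with h | h
    · exact ⟨(key h0 h0 (self h0) h).trans m0, (key h0 h1 h01 h).trans m0⟩
    · exact ⟨(key h1 h0 h10 h).trans m1, (key h1 h1 (self h1) h).trans m1⟩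
  refine max_le ?_ ?_
  · simp only [hn₀, add_div]
    linarith [extra.1]
  · simp only [hn₁, add_div]
    linarith [extra.2]

theorem stepCondition_ceil {d : ℕ} {E : ℝ → Fin (d + 2) → ℝ} {T W a : ℝ} (hT : 0 < T)
    (hW : ∀ s ∈ Icc (0 : ℝ) 1, ∀ l, E s l - E s 0 ≤ W) (ha : W / 3.78 < a) :
    0 < ⌈a * T⌉₊ ∧ StepCondition E T ⌈a * T⌉₊ := by
  -- The level `l = 0` gives `0 ≤ W`, needed for `W * (T / L)` to decrease as `⌈a T⌉₊` replaces `a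
  -- T`.
  have hW0 : 0 ≤ W := by simpa using hW 0 (by simp) 0
  have ha0 : 0 < a := lt_of_le_of_lt (by positivity) ha
  have haT : 0 < a * T := by positivity
  have hceil : a * T ≤ ⌈a * T⌉₊ := Nat.le_ceil _
  refine ⟨Nat.ceil_pos.2 haT, fun s hs l => ?_⟩
  calc (E s l - E s 0) * (T / ⌈a * T⌉₊) ≤ W * (T / (a * T)) := by
        gcongr
        exact hW s hs l
    _ = W / a := by field_simp
    _ < 3.78 := by
        rw [div_lt_iff₀ ha0]
        rw [div_lt_iff₀ (by norm_num)] at ha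
        linarith

end DiscreteAdiabatic

/-! ### The three claims -/

open DiscreteAdiabatic in
theorem corollary1 :
    ∃ C : ℝ, 0 < C ∧
    ∀ (d : ℕ) (H : ℝ → ℝ → Op (d + 2)) (E : ℝ → ℝ → Fin (d + 2) → ℝ),
      -- for every `T`, `H T` is a three times continuously differentiable path of Hamiltonians
      (∀ T > 0, ContDiffOn ℝ 3 (H T) (Icc 0 1)) →
      (∀ T > 0, ∀ s ∈ Icc (0 : ℝ) 1, IsSelfAdjoint (H T s)) →
      -- with non-degenerate energy levels `E T s 0 < E T s 1 < ⋯`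
      (∀ T > 0, ∀ s ∈ Icc (0 : ℝ) 1, IsEnergyLevels (H T s) (E T s)) →
      -- `‖H'‖ = O(1)`, `‖H''‖ = o(√T)` and `‖H'''‖ = o(T)` as `T → ∞`, uniformly in `s`
      (∃ K : ℝ, ∀ᶠ T in atTop, ∀ s ∈ Icc (0 : ℝ) 1, ‖pathDeriv 1 (H T) s‖ ≤ K) →
      (∀ ε > 0, ∀ᶠ T in atTop, ∀ s ∈ Icc (0 : ℝ) 1, ‖pathDeriv 2 (H T) s‖ ≤ ε * Real.sqrt T) →
      (∀ ε > 0, ∀ᶠ T in atTop, ∀ s ∈ Icc (0 : ℝ) 1, ‖pathDeriv 3 (H T) s‖ ≤ ε * T) →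
      -- all level spacings are bounded below by a positive constant
      (∃ g > 0, ∀ᶠ T in atTop, ∀ s ∈ Icc (0 : ℝ) 1, ∀ l m, l ≠ m →
        g ≤ |E T s l - E T s m|) →
      -- the error bound, when `H'` does not become arbitrarily small at both endpoints
      ((∃ κ > 0, ∀ᶠ T in atTop, κ ≤ max ‖pathDeriv 1 (H T) 0‖ ‖pathDeriv 1 (H T) 1‖) →
        ∀ᶠ T in atTop, ∀ L : ℕ, 0 < L → StepCondition (E T) T L →
          ErrorAtMost (H T) (E T) T L
            (C * endpointMax (fun s => ‖pathDeriv 1 (H T) s‖) (E T) T)) ∧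
      -- without that proviso, the same bound up to terms of lower order
      (∀ η > 0, ∀ᶠ T in atTop, ∀ L : ℕ, 0 < L → StepCondition (E T) T L →
        ErrorAtMost (H T) (E T) T L
          (C * endpointMax (fun s => ‖pathDeriv 1 (H T) s‖ + η) (E T) T)) ∧
      -- if the spectral width is bounded, a number of steps linear in `T` achieves error `O(1/T)`
      (∀ W : ℝ, (∀ᶠ T in atTop, ∀ s ∈ Icc (0 : ℝ) 1, ∀ l, E T s l - E T s 0 ≤ W) →
        ∀ a > W / 3.78, ∃ K : ℝ, ∀ᶠ T in atTop,
          StepCondition (E T) T ⌈a * T⌉₊ ∧ ErrorAtMost (H T) (E T) T ⌈a * T⌉₊ (K / T)) := by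
  refine ⟨6400, by norm_num, ?_⟩
  intro d H E hH hA hE ⟨K₀, hK₀⟩ h2 h3 ⟨g, hg, hgap₀⟩
  set K : ℝ := max K₀ 0 with hK
  have hK0 : 0 ≤ K := le_max_right _ _
  have h1 : ∀ᶠ T in atTop, ∀ s ∈ Icc (0 : ℝ) 1, ‖pathDeriv 1 (H T) s‖ ≤ K :=
    hK₀.mono fun T h s hs => (h s hs).trans (le_max_left _ _)
  have hgap : ∀ᶠ T in atTop, ∀ s ∈ Icc (0 : ℝ) 1, g ≤ gap (E T s) := by
    filter_upwards [hgap₀, eventually_gt_atTop 0] with T h hT s hs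
    have := h s hs 1 0 (by simp)
    rwa [← gap, abs_of_pos (gap_pos (hE T hT s hs).1)] at this
  have m0 : (0 : ℝ) ∈ Icc (0 : ℝ) 1 := by simp
  have m1 : (1 : ℝ) ∈ Icc (0 : ℝ) 1 := by simp
  have main := fun {η : ℝ} (hη : 0 < η) =>
    eventually_errorAtMost hH hA hE hK0 hg h1 h2 h3 hgap hη
  refine ⟨?_, ?_, ?_⟩
  · rintro ⟨κ, hκ, hmax⟩
    set q : ℝ := 1 + 2 * K / g with hq
    have hq1 : 1 ≤ q := by
      have : 0 ≤ 2 * K / g := by positivity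
      linarith
    -- With this `η` the extra term at most doubles the bound, which is why `C = 6400` is twice
    -- `3200`.
    filter_upwards [main (η := κ / q ^ 2) (by positivity), hmax, h1, hgap, eventually_gt_atTop 0]
      with T hT hmax h1 hgap hT0 L hL hstep
    have compare : ∀ s ∈ Icc (0 : ℝ) 1, ∀ t ∈ Icc (0 : ℝ) 1,
        gap (E T t) ≤ q * gap (E T s) := by
      intro s hs t ht
      have k1 := gap_le_gap_add_path (hH T hT0) (hA T hT0) (hE T hT0) h1 hs ht
      have k2 : K * |t - s| ≤ K * 1 := by
        gcongr
        exact abs_sub_le_iff.2 ⟨by linarith [ht.2, hs.1], by linarith [ht.1, hs.2]⟩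
      have k3 : 2 * K / g * g ≤ 2 * K / g * gap (E T s) := by
        gcongr
        exact hgap s hs
      rw [div_mul_cancel₀ _ hg.ne'] at k3
      rw [hq]
      linarith
    refine (hT L hL hstep).mono ?_
    have := endpointMax_add_le (a := fun s => ‖pathDeriv 1 (H T) s‖) hT0 hq1 hκ
      (hg.trans_le (hgap 0 m0)) (hg.trans_le (hgap 1 m1)) (compare 1 m1 0 m0) (compare 0 m0 1 m1)
      rfl rfl hmax
    linarith
  · intro η hη
    filter_upwards [main hη, eventually_gt_atTop 0] with T hT hT0 L hL hstep
    refine (hT L hL hstep).mono ?_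
    have : 0 ≤ endpointMax (fun s => ‖pathDeriv 1 (H T) s‖ + η) (E T) T :=
      le_max_of_le_left (by positivity)
    linarith
  · intro W hW a ha
    -- The second claim with `η = 1`, bounding `‖H'‖` by `K` and both endpoint gaps below by `g`.
    refine ⟨3200 * ((K + 1) / g ^ 2), ?_⟩
    filter_upwards [main one_pos, hW, h1, hgap, eventually_gt_atTop 0]
      with T hT hW h1 hgap hT0
    obtain ⟨hL, hstep⟩ := stepCondition_ceil hT0 hW ha
    refine ⟨hstep, (hT _ hL hstep).mono ?_⟩
    rw [mul_div_assoc, div_div, mul_comm (g ^ 2)]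
    gcongr
    refine max_le ?_ ?_
    · have := hgap 0 m0
      gcongr
      exact add_le_add_left (h1 0 m0) 1
    · have := hgap 1 m1
      gcongr
      exact add_le_add_left (h1 1 m1) 1
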